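/- Let $(X_i,\varepsilon_i,\delta_i)_{i\ge 1}$ be i.i.d. with values in $\Upsilon\times\mathbb R\times\{0,1\}$, where $\Upsilon\subset\mathbb R^p$ is compact and the law of $(\varepsilon_i,X_i)$ has a density with respect to Lebesgue measure. Let $\Gamma\subset\mathbb R^d$ be compact, $f:\Upsilon\times\Gamma\to\mathbb R$, $\beta^0$ an interior point of $\Gamma$, and $Y_i=f(X_i,\beta^0)+\varepsilon_i$. The response $Y_i$ is observed if $\delta_i=1$ and missing if $\delta_i=0$. It is missing at random: $P[\delta_i=1\mid X_i,Y_i]=P[\delta_i=1\mid X_i]=\pi(X_i)$ a.s., where $\pi(x)=P[\delta=1\mid X=x]>0$ for all $x\in\Upsilon$. The model is identifiable: for $\beta,\beta^*\in\Gamma$, if $f(X,\beta)=f(X,\beta^*)$ a.s. then $\beta=\beta^*$. Write $\dot f=\partial f/\partial\beta$, $\ddot f=\partial^2 f/\partial\beta^2$, and let $(\varepsilon,X)$ denote a pair with the common law of the $(\varepsilon_i,X_i)$. Define $$g_{i,LS}(\beta)=\delta_i\,[Y_i-f(X_i,\beta)]\,\dot f(X_i,\beta),\qquad g_{i,LAD}(\beta)=\delta_i\,\mathrm{sign}(Y_i-f(X_i,\beta))\,\dot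 f(X_i,\beta),$$ and, with $g_i=g_{i,LS}$ or $g_i=g_{i,LAD}$, the empirical log-likelihood ratio $$l_n(\beta)=-2\sup\Big\{\sum_{i=1}^n\log(np_i)\;:\;(p_1,\dots,p_n)\in(0,1)^n,\ \sum_{i=1}^n p_i=1,\ \sum_{i=1}^n p_i\,g_i(\beta)=0\Big\},$$ with $\sup\emptyset=-\infty$, so that $l_n(\beta)=+\infty$ when no such $p$ exists. Consider the assumptions: - (H1) $E|\varepsilon|<\infty$, $E[\varepsilon\mid X]=0$ and $E[\varepsilon^2\mid X]<\infty$ a.s., and the matrix $B=E[\varepsilon^2\pi(X)\dot f(X,\beta^0)\dot f^t(X,\beta^0)]$ is well defined, that is, its entries are expectations of integrable variables. - (H1bis) $E[\mathrm{sign}(\varepsilon)\mid X]=0$ a.s., and $\varepsilon$ has a continuous density $e$ with $e(0)>0$. - (H2) For every $x\in\Upsilon$, $f(x,\cdot)$ is twice differentiable on $\Gamma$; for every $\beta\in\Gamma$, $f(\cdot,\beta)$ is continuous on $\Upsilon$. - (H4) $\|\dot f(x,\beta)\|$ and $\|\ddot f(x,\beta)\|$ are bounded uniformly over $x\in\Upsilon$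 and $\beta$ in a neighborhood of $\beta^0$. - (HA) The matrix $A=E[\pi(X)\dot f(X,\beta^0)\dot f^t(X,\beta^0)]$ is positive definite. Theorem. Assume (H2), (H4) and (HA). If (H1) holds and $g_i=g_{i,LS}$, then $l_n(\beta^0)$ converges in distribution to $\chi^2(d)$ as $n\to\infty$. If (H1bis) holds and $g_i=g_{i,LAD}$, then $l_n(\beta^0)$ converges in distribution to $\chi^2(d)$ as $n\to\infty$. -/

import Mathlib

open MeasureTheory ProbabilityTheory Filter Topology

noncomputable section

/-- `ℝᵏ` with the Euclidean norm. -/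
abbrev Euc (k : ℕ) : Type := EuclideanSpace ℝ (Fin k)

/-! ### The limit law -/

/-- The chi-squared law with `d` degrees of freedom: the law of `Z₁² + ⋯ + Z_d²` for
independent standard normal variables `Z₁, …, Z_d`. -/
def chiSquared (d : ℕ) : Measure ℝ :=
  (Measure.pi fun _ : Fin d => gaussianReal 0 1).map fun z => ∑ j, z j ^ 2

instance instIsProbabilityMeasureChiSquared (d : ℕ) : IsProbabilityMeasure (chiSquared d) :=
  Measure.isProbabilityMeasure_map (Measurable.aemeasurable
    (Finset.measurable_sum _ fun j _ => (measurable_pi_apply j).pow_const 2))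

/-! ### Empirical likelihood -/

/-- The weights `(p₁, …, pₙ) ∈ (0,1)ⁿ` with `∑ pᵢ = 1` and `∑ pᵢ gᵢ = 0`. -/
def elWeights {n d : ℕ} (g : Fin n → Euc d) : Set (Fin n → ℝ) :=
  {p | (∀ i, p i ∈ Set.Ioo (0 : ℝ) 1) ∧ ∑ i, p i = 1 ∧ ∑ i, p i • g i = 0}

/-- The empirical log-likelihood ratio `-2 sup {∑ log (n pᵢ)}` over the admissible weights.
The supremum is taken in the extended reals: it is `-∞` (and the ratio is `+∞`) when there are
no admissible weights. -/
def elLogRatio {n d : ℕ} (g : Fin n → Euc d) : EReal :=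
  ((-2 : ℝ) : EReal) * ⨆ p ∈ elWeights g, ((∑ i, Real.log ((n : ℝ) * p i) : ℝ) : EReal)

/-! ### The regression function and the estimating functions -/

/-- The gradient `∂f(x,β)/∂β`. -/
def gradBeta {p d : ℕ} (f : Euc p → Euc d → ℝ) (x : Euc p) (b : Euc d) : Euc d :=
  gradient (f x) b

/-- The second derivative `∂²f(x,β)/∂β²`, as a linear operator. -/
def hessBeta {p d : ℕ} (f : Euc p → Euc d → ℝ) (x : Euc p) (b : Euc d) : Euc d →L[ℝ] Euc d :=
  fderiv ℝ (gradBeta f x) b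

/-- The complete-case least squares estimating function `δ (y - f(x,β)) ∂f(x,β)/∂β`. -/
def scoreLS {p d : ℕ} (f : Euc p → Euc d → ℝ) (b : Euc d) (x : Euc p) (y δ : ℝ) : Euc d :=
  (δ * (y - f x b)) • gradBeta f x b

/-- The complete-case least absolute deviations estimating function
`δ sign(y - f(x,β)) ∂f(x,β)/∂β`. -/
def scoreLAD {p d : ℕ} (f : Euc p → Euc d → ℝ) (b : Euc d) (x : Euc p) (y δ : ℝ) : Euc d :=
  (δ * Real.sign (y - f x b)) • gradBeta f x b

/-- The statistic `lₙ(β)` for least squares, from the first `n` observations. -/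
def lLS {Ω : Type*} {p d : ℕ} (f : Euc p → Euc d → ℝ) (X : ℕ → Ω → Euc p) (Y δ : ℕ → Ω → ℝ)
    (n : ℕ) (b : Euc d) (ω : Ω) : EReal :=
  elLogRatio fun i : Fin n => scoreLS f b (X i ω) (Y i ω) (δ i ω)

/-- The statistic `lₙ(β)` for least absolute deviations, from the first `n` observations. -/
def lLAD {Ω : Type*} {p d : ℕ} (f : Euc p → Euc d → ℝ) (X : ℕ → Ω → Euc p) (Y δ : ℕ → Ω → ℝ)
    (n : ℕ) (b : Euc d) (ω : Ω) : EReal :=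
  elLogRatio fun i : Fin n => scoreLAD f b (X i ω) (Y i ω) (δ i ω)

/-! ### The model -/

/-- The σ-algebra generated by a random variable. -/
abbrev sigmaOf {Ω S : Type*} [MeasurableSpace S] (Z : Ω → S) : MeasurableSpace Ω :=
  MeasurableSpace.comap Z inferInstance

/-- The random nonlinear regression model `Yᵢ = f(Xᵢ,β⁰) + εᵢ` with responses missing at random.
Here `δᵢ = 1` if `Yᵢ` is observed and `δᵢ = 0` if it is missing, and `sel` is the selection
probability function `x ↦ P[δ = 1 | X = x]`. -/
structure IsMARModel {Ω : Type*} [MeasurableSpace Ω] (P : Measure Ω) {p d : ℕ}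
    (Υ : Set (Euc p)) (Γ : Set (Euc d)) (f : Euc p → Euc d → ℝ) (β₀ : Euc d)
    (X : ℕ → Ω → Euc p) (ε Y δ : ℕ → Ω → ℝ) (sel : Euc p → ℝ) : Prop where
  isCompact_covariates : IsCompact Υ
  isCompact_parameters : IsCompact Γ
  true_mem_interior : β₀ ∈ interior Γ
  measurable_X : ∀ i, Measurable (X i)
  measurable_ε : ∀ i, Measurable (ε i)
  measurable_δ : ∀ i, Measurable (δ i)
  X_mem : ∀ i ω, X i ω ∈ Υ
  δ_mem : ∀ i ω, δ i ω = 0 ∨ δ i ω = 1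
  regression : ∀ i ω, Y i ω = f (X i ω) β₀ + ε i ω
  /-- the observations are independent … -/
  indep : iIndepFun (fun i ω => (ε i ω, X i ω, δ i ω)) P
  /-- … and identically distributed -/
  identDistrib : ∀ i, IdentDistrib (fun ω => (ε i ω, X i ω, δ i ω))
    (fun ω => (ε 0 ω, X 0 ω, δ 0 ω)) P P
  /-- `(ε, X)` is a continuous random vector: its law has a Lebesgue density -/
  continuous_law : P.map (fun ω => (ε 0 ω, X 0 ω)) ≪ volume
  /-- identifiability -/
  identifiable : ∀ b ∈ Γ, ∀ b' ∈ Γ, (∀ᵐ ω ∂P, f (X 0 ω) b = f (X 0 ω) b') → b = b'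
  /-- missing at random: `P[δᵢ = 1 | Xᵢ, Yᵢ] = P[δᵢ = 1 | Xᵢ]` -/
  missing_at_random : ∀ i,
    P⟦{ω | δ i ω = 1} | sigmaOf fun ω => (X i ω, Y i ω)⟧ =ᵐ[P]
      P⟦{ω | δ i ω = 1} | sigmaOf (X i)⟧
  measurable_sel : Measurable sel
  selection : ∀ i, P⟦{ω | δ i ω = 1} | sigmaOf (X i)⟧ =ᵐ[P] fun ω => sel (X i ω)
  selection_pos : ∀ x ∈ Υ, 0 < sel x

/-! ### The assumptions -/

/-- `h` is twice differentiable on `s`. -/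
def TwiceDifferentiableOn {d : ℕ} (h : Euc d → ℝ) (s : Set (Euc d)) : Prop :=
  ∃ h' : Euc d → Euc d, (∀ b ∈ s, HasGradientWithinAt h (h' b) s b) ∧ DifferentiableOn ℝ h' s

/-- The function `f(x,β)` is twice differentiable in `β ∈ Γ` and continuous in `x ∈ Υ`. -/
def AssumptionH2 {p d : ℕ} (Υ : Set (Euc p)) (Γ : Set (Euc d)) (f : Euc p → Euc d → ℝ) : Prop :=
  (∀ x ∈ Υ, TwiceDifferentiableOn (f x) Γ) ∧ ∀ b ∈ Γ, ContinuousOn (fun x => f x b) Υ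

/-- The first two derivatives in `β` are bounded for `x ∈ Υ` and `β` near `β⁰`. -/
def AssumptionH4 {p d : ℕ} (Υ : Set (Euc p)) (f : Euc p → Euc d → ℝ) (β₀ : Euc d) : Prop :=
  ∃ C : ℝ, ∀ᶠ b in 𝓝 β₀, ∀ x ∈ Υ, ‖gradBeta f x b‖ ≤ C ∧ ‖hessBeta f x b‖ ≤ C

/-- The matrix `A = E[π(X) ḟ(X,β⁰) ḟ(X,β⁰)ᵗ]`, where `π` is the selection probability `sel`. -/
def matA {Ω : Type*} [MeasurableSpace Ω] (P : Measure Ω) {p d : ℕ}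
    (f : Euc p → Euc d → ℝ) (β₀ : Euc d) (X : Ω → Euc p) (sel : Euc p → ℝ) :
    Matrix (Fin d) (Fin d) ℝ :=
  Matrix.of fun j k => ∫ ω, sel (X ω) * gradBeta f (X ω) β₀ j * gradBeta f (X ω) β₀ k ∂P

/-- The least squares error condition: `E[ε|X] = 0` and `E[ε²|X] < ∞`, with the matrix
`B = E[ε² π(X) ḟ(X,β⁰) ḟ(X,β⁰)ᵗ]` well defined. -/
structure AssumptionH1 {Ω : Type*} [MeasurableSpace Ω] (P : Measure Ω) {p d : ℕ}
    (f : Euc p → Euc d → ℝ) (β₀ : Euc d) (X : ℕ → Ω → Euc p) (ε : ℕ → Ω → ℝ)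
    (sel : Euc p → ℝ) : Prop where
  integrable : ∀ i, Integrable (ε i) P
  condMean : ∀ i, P[ε i | sigmaOf (X i)] =ᵐ[P] 0
  condSecondMoment : ∀ i, ∀ᵐ ω ∂P,
    condLExp (sigmaOf (X i)) P (fun ω' => ENNReal.ofReal (ε i ω' ^ 2)) ω < ⊤
  finite_B : ∀ j k, Integrable
    (fun ω => ε 0 ω ^ 2 * sel (X 0 ω) * gradBeta f (X 0 ω) β₀ j * gradBeta f (X 0 ω) β₀ k) P

/-- The least absolute deviations error condition: `E[sign(ε)|X] = 0` and `ε` has a continuous density `e` with `e(0) > 0`. -/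
structure AssumptionH1bis {Ω : Type*} [MeasurableSpace Ω] (P : Measure Ω) {p : ℕ}
    (X : ℕ → Ω → Euc p) (ε : ℕ → Ω → ℝ) : Prop where
  condSign : ∀ i, P[fun ω => Real.sign (ε i ω) | sigmaOf (X i)] =ᵐ[P] 0
  density : ∃ e : ℝ → ℝ, Continuous e ∧ (∀ t, 0 ≤ e t) ∧ 0 < e 0 ∧
    ∀ i, P.map (ε i) = volume.withDensity fun t => ENNReal.ofReal (e t)

end

/-!
# Empirical likelihood for nonlinear regression with responses missing at random

The estimating functions at `β⁰` are i.i.d. centred vectors `gᵢ = δᵢ s(εᵢ) ∂f(Xᵢ,β⁰)/∂β`, with `s`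
the identity or the sign, so the theorem is an instance of Owen's theorem
(`tendstoInDistribution_elLogRatio`): the empirical log-likelihood ratio of i.i.d. centred vectors
with positive definite covariance matrix is asymptotically chi-squared.

Owen's theorem is proved without solving the Lagrange equation. The ratio is invariant under
invertible linear maps, so the covariance matrix may be taken to be the identity. Let `m` be the mean
of `g₁, …, gₙ`. Weak duality with the explicit multiplier `m` gives
`lₙ ≥ 2 ∑ log (1 + ⟪m, gᵢ⟫)`, and the explicit weights `pᵢ = (1 - ⟪v, gᵢ - m⟫) / n`, where `v` solves
the *linear* system `∑ ⟪gᵢ - m, v⟫ (gᵢ - m) = n m`, give `lₙ ≤ -2 ∑ log (1 - ⟪v, gᵢ - m⟫)`. By a second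
order expansion both bounds are `n ‖m‖² (1 + O(η))`, where `η` bounds the deviation of the empirical
second moments from the identity and the product of `‖m‖` with `max ‖gᵢ‖`
(`le_elLogRatio_of_near_isotropic`, `elLogRatio_le_of_near_isotropic`). By the strong law of large
numbers the second moments converge and `max ‖gᵢ‖ = o(√n)`, and by the central limit theorem `√n m` is
asymptotically standard normal; hence `η → 0` in probability and `n ‖m‖²` has the chi-squared limit.

For the regression model, `ε` is a function of `(X, Y)`, so missingness at random says that the law
of `(ε, X)` on the observed cases has density `sel` (`IsMARModel.map_restrict_observed`). Thus
`E[δ h(ε, X)] = E[sel(X) h(ε, X)]`, which identifies the mean and the covariance of the score. The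
covariance matrix is `E[s(ε)² sel(X) ∂f ∂fᵗ]`; since `(ε, X)` has a Lebesgue density, `ε ≠ 0` almost
surely, and positive definiteness is inherited from the matrix `A`.
-/

/-! ### Deterministic bounds for the empirical log-likelihood ratio -/

lemma abs_log_one_add_sub_le {a : ℝ} (ha : |a| ≤ 1 / 2) :
    |Real.log (1 + a) - (a - a ^ 2 / 2)| ≤ 2 * |a| * a ^ 2 := by
  have h := Real.abs_log_sub_add_sum_range_le (x := -a) (by rw [abs_neg]; linarith) 2
  rw [abs_neg] at h
  have h3 : |a| ^ (2 + 1) / (1 - |a|) ≤ 2 * |a| * a ^ 2 := by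
    rw [div_le_iff₀ (by linarith), ← sq_abs a]
    have h4 : 0 ≤ |a| * |a| ^ 2 * (1 - 2 * |a|) := mul_nonneg (by positivity) (by linarith)
    rw [show |a| ^ (2 + 1) = |a| * |a| ^ 2 by ring]
    linarith
  refine le_trans (le_of_eq ?_) (h.trans h3)
  congr 1
  simp [Finset.sum_range_succ]
  ring

lemma neg_two_mul_antitone {x y : EReal} (h : x ≤ y) :
    ((-2 : ℝ) : EReal) * y ≤ ((-2 : ℝ) : EReal) * x := by
  rw [show ((-2 : ℝ) : EReal) = -((2 : ℝ) : EReal) by simp, EReal.neg_mul, EReal.neg_mul,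
    EReal.neg_le_neg_iff]
  exact mul_le_mul_of_nonneg_left h (by exact_mod_cast (by norm_num : (0 : ℝ) ≤ 2))

lemma elLogRatio_le {n d : ℕ} {g : Fin n → Euc d} {p : Fin n → ℝ} (hp : p ∈ elWeights g) {c : ℝ}
    (h : -2 * ∑ i, Real.log (n * p i) ≤ c) : elLogRatio g ≤ c := by
  refine (neg_two_mul_antitone (le_iSup₂_of_le p hp le_rfl)).trans ?_
  rw [← EReal.coe_mul]
  exact_mod_cast h

lemma le_elLogRatio {n d : ℕ} {g : Fin n → Euc d} {c : ℝ}
    (h : ∀ p ∈ elWeights g, c ≤ -2 * ∑ i, Real.log (n * p i)) : (c : EReal) ≤ elLogRatio g := by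
  have h1 : (⨆ p ∈ elWeights g, ((∑ i, Real.log ((n : ℝ) * p i) : ℝ) : EReal)) ≤
      ((-c / 2 : ℝ) : EReal) := by
    refine iSup₂_le fun p hp => ?_
    have := h p hp
    exact_mod_cast (by linarith : ∑ i, Real.log ((n : ℝ) * p i) ≤ -c / 2)
  refine le_trans (le_of_eq ?_) (neg_two_mul_antitone h1)
  rw [← EReal.coe_mul]
  congr 1
  ring

/-- Weak duality: every multiplier `v` with `1 + ⟪v, gᵢ⟫ > 0` bounds the ratio from below. -/
lemma dual_le_elLogRatio {n d : ℕ} {g : Fin n → Euc d} (v : Euc d)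
    (hv : ∀ i, 0 < 1 + inner ℝ v (g i)) :
    ((2 * ∑ i, Real.log (1 + inner ℝ v (g i)) : ℝ) : EReal) ≤ elLogRatio g := by
  refine le_elLogRatio fun p ⟨hp, hp1, hpg⟩ => ?_
  have h1 : ∑ i, (Real.log (n * p i) + Real.log (1 + inner ℝ v (g i))) ≤
      ∑ i, (n * (p i + inner ℝ v (p i • g i)) - 1) := by
    refine Finset.sum_le_sum fun i _ => ?_
    have hn : (0 : ℝ) < n := by exact_mod_cast Fin.pos i
    have := (hp i).1
    rw [← Real.log_mul (by positivity) (hv i).ne', inner_smul_right]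
    refine (Real.log_le_sub_one_of_pos (mul_pos (by positivity) (hv i))).trans (le_of_eq ?_)
    ring
  rw [Finset.sum_add_distrib, Finset.sum_sub_distrib, ← Finset.mul_sum, Finset.sum_add_distrib,
    ← inner_sum, hpg, hp1] at h1
  simp at h1
  linarith

/-- Solvability of the linear equation `∑ᵢ ⟪cᵢ, v⟫ cᵢ = w` for vectors `cᵢ` that span. -/
lemma exists_sum_inner_smul_eq {n d : ℕ} (c : Fin n → Euc d)
    (hc : ∀ x, x ≠ 0 → 0 < ∑ i, inner ℝ (c i) x ^ 2) (w : Euc d) :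
    ∃ v, ∑ i, inner ℝ (c i) v • c i = w := by
  let T : Euc d →ₗ[ℝ] Euc d := ∑ i, (innerₛₗ ℝ (c i)).smulRight (c i)
  have hT : ∀ x, T x = ∑ i, inner ℝ (c i) x • c i := fun x => by simp [T]
  have hinj : Function.Injective T := by
    rw [← LinearMap.ker_eq_bot, LinearMap.ker_eq_bot']
    intro x hx
    by_contra hx0
    have h := hc x hx0
    have h2 : inner ℝ (T x) x = ∑ i, inner ℝ (c i) x ^ 2 := by
      rw [hT, sum_inner]
      exact Finset.sum_congr rfl fun i _ => by rw [inner_smul_left]; simp; ring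
    rw [hx, inner_zero_left] at h2
    linarith
  obtain ⟨v, hv⟩ := LinearMap.injective_iff_surjective.1 hinj w
  exact ⟨v, by rw [← hT, hv]⟩

/-- Lower half of the approximation of the ratio by `n ‖m‖²` when the vectors `zᵢ` are nearly
isotropic and their mean `m` is small compared with `1 / ‖zᵢ‖`: weak duality with multiplier `m`. -/
lemma le_elLogRatio_of_near_isotropic {n d : ℕ} {z : Fin n → Euc d} {m : Euc d} {η : ℝ}
    (hη : η ≤ 1 / 8) (hm : ∑ i, z i = (n : ℝ) • m)
    (hS : ∀ x, |∑ i, inner ℝ (z i) x ^ 2 - n * ‖x‖ ^ 2| ≤ n * η * ‖x‖ ^ 2)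
    (hmax : ∀ i, ‖m‖ * ‖z i‖ ≤ η) :
    ((n * ‖m‖ ^ 2 * (1 - 28 * η) : ℝ) : EReal) ≤ elLogRatio z := by
  have ha : ∀ i, |inner ℝ m (z i)| ≤ η := fun i => (abs_real_inner_le_norm _ _).trans (hmax i)
  refine le_trans ?_ (dual_le_elLogRatio m fun i => ?_)
  · rw [EReal.coe_le_coe_iff]
    have h1 : ∑ i, (inner ℝ m (z i) - (1 / 2 + 2 * η) * inner ℝ (z i) m ^ 2) ≤
        ∑ i, Real.log (1 + inner ℝ m (z i)) := by
      refine Finset.sum_le_sum fun i _ => ?_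
      have h := (abs_le.1 (abs_log_one_add_sub_le ((ha i).trans (by linarith)))).1
      rw [real_inner_comm m (z i)]
      nlinarith [ha i, sq_nonneg (inner ℝ m (z i))]
    rw [Finset.sum_sub_distrib, ← Finset.mul_sum, ← inner_sum, hm, inner_smul_right,
      real_inner_self_eq_norm_sq] at h1
    have h2 := (abs_le.1 (hS m)).2
    rcases Nat.eq_zero_or_pos n with rfl | hn
    · simp
    have hη0 : 0 ≤ η := (abs_nonneg _).trans (ha ⟨0, hn⟩)
    have hQ : 0 ≤ n * ‖m‖ ^ 2 := by positivity
    nlinarith [mul_le_mul_of_nonneg_left h2 (by linarith : 0 ≤ 1 / 2 + 2 * η), mul_nonneg hQ hη0,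
      mul_le_mul_of_nonneg_left hη (mul_nonneg hQ hη0)]
  · have := (abs_le.1 (ha i)).1
    linarith

/-- Upper half of the approximation of the ratio by `n ‖m‖²`: the weights are
`(1 - ⟪v, zᵢ - m⟫) / n`, affine in `zᵢ`, with `v` chosen such that `∑ pᵢ zᵢ = 0`. -/
lemma elLogRatio_le_of_near_isotropic {n d : ℕ} (hn : 2 ≤ n) {z : Fin n → Euc d} {m : Euc d}
    {η : ℝ} (hη : η ≤ 1 / 8) (hm : ∑ i, z i = (n : ℝ) • m)
    (hS : ∀ x, |∑ i, inner ℝ (z i) x ^ 2 - n * ‖x‖ ^ 2| ≤ n * η * ‖x‖ ^ 2)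
    (hmax : ∀ i, ‖m‖ * ‖z i‖ ≤ η) :
    elLogRatio z ≤ ((n * ‖m‖ ^ 2 * (1 + 28 * η) : ℝ) : EReal) := by
  have hn0 : (0 : ℝ) < n := by exact_mod_cast (by omega : 0 < n)
  have hn2 : (2 : ℝ) ≤ n := by exact_mod_cast hn
  have hη0 : 0 ≤ η := (mul_nonneg (norm_nonneg _) (norm_nonneg _)).trans (hmax ⟨0, by omega⟩)
  -- the mean is no longer than the longest vector
  have hm2 : ‖m‖ ^ 2 ≤ η := by
    have h1 : (n : ℝ) * ‖m‖ ^ 2 ≤ n * η := by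
      calc (n : ℝ) * ‖m‖ ^ 2 = ‖m‖ * ‖(n : ℝ) • m‖ := by rw [norm_smul]; simp; ring
        _ ≤ ‖m‖ * ∑ i, ‖z i‖ := by rw [← hm]; gcongr; exact norm_sum_le _ _
        _ ≤ ∑ _i : Fin n, η := by rw [Finset.mul_sum]; exact Finset.sum_le_sum fun i _ => hmax i
        _ = n * η := by simp
    exact le_of_mul_le_mul_left h1 hn0
  set c : Fin n → Euc d := fun i => z i - m with hc
  have hcsum : ∑ i, c i = 0 := by simp [hc, hm, Nat.cast_smul_eq_nsmul]
  have hquad : ∀ x, n * (1 - 2 * η) * ‖x‖ ^ 2 ≤ ∑ i, inner ℝ (c i) x ^ 2 := by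
    intro x
    have h1 : ∑ i, inner ℝ (c i) x ^ 2 = ∑ i, inner ℝ (z i) x ^ 2 - n * inner ℝ m x ^ 2 := by
      have : ∑ i, inner ℝ (z i) x = n * inner ℝ m x := by
        rw [← sum_inner, hm, inner_smul_left]; simp
      calc _ = ∑ i, (inner ℝ (z i) x ^ 2 - 2 * inner ℝ m x * inner ℝ (z i) x
            + inner ℝ m x ^ 2) :=
            Finset.sum_congr rfl fun i _ => by simp only [hc]; rw [inner_sub_left]; ring
        _ = _ := by
            rw [Finset.sum_add_distrib, Finset.sum_sub_distrib, ← Finset.mul_sum, this]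
            simp; ring
    have h2 := (abs_le.1 (hS x)).1
    have h3 : inner ℝ m x ^ 2 ≤ η * ‖x‖ ^ 2 := by
      calc inner ℝ m x ^ 2 ≤ (‖m‖ * ‖x‖) ^ 2 := by
            rw [← sq_abs]; gcongr; exact abs_real_inner_le_norm _ _
        _ = ‖m‖ ^ 2 * ‖x‖ ^ 2 := by ring
        _ ≤ _ := by gcongr
    nlinarith
  have hcpos : ∀ x, x ≠ 0 → 0 < ∑ i, inner ℝ (c i) x ^ 2 := fun x hx =>
    lt_of_lt_of_le (mul_pos (mul_pos hn0 (by linarith)) (pow_pos (norm_pos_iff.2 hx) 2)) (hquad x)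
  obtain ⟨v, hv⟩ := exists_sum_inner_smul_eq c hcpos ((n : ℝ) • m)
  have hq : ∑ i, inner ℝ (c i) v ^ 2 = n * inner ℝ m v := by
    have h := congrArg (fun y => inner ℝ y v) hv
    simp only [sum_inner, inner_smul_left] at h
    simp at h
    rw [← h]
    exact Finset.sum_congr rfl fun i _ => by ring
  have hmv : inner ℝ m v ≤ ‖m‖ * ‖v‖ := real_inner_le_norm _ _
  have hv1 : (1 - 2 * η) * ‖v‖ ≤ ‖m‖ := by
    have h1 : n * ((1 - 2 * η) * ‖v‖ ^ 2) ≤ n * (‖m‖ * ‖v‖) := by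
      have := hquad v
      rw [hq] at this
      nlinarith
    have h2 := le_of_mul_le_mul_left h1 hn0
    rcases eq_or_lt_of_le (norm_nonneg v) with h0 | h0
    · rw [← h0]; simp
    · exact le_of_mul_le_mul_right (by nlinarith) h0
  -- `(1 + 4η)(1 - 2η) ≥ 1` for `0 ≤ η ≤ 1 / 8`
  have hv4 : ‖v‖ ≤ (1 + 4 * η) * ‖m‖ := by
    have h1 : (1 + 4 * η) * ((1 - 2 * η) * ‖v‖) ≤ (1 + 4 * η) * ‖m‖ := by gcongr
    nlinarith [mul_nonneg (mul_nonneg hη0 (by linarith : 0 ≤ 1 / 8 - η)) (norm_nonneg v),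
      mul_nonneg hη0 (norm_nonneg v)]
  have hsum2 : ∑ i, inner ℝ (c i) v ^ 2 ≤ n * ‖m‖ ^ 2 * (1 + 4 * η) := by
    rw [hq]
    have : inner ℝ m v ≤ ‖m‖ * ((1 + 4 * η) * ‖m‖) := hmv.trans (by gcongr)
    nlinarith
  have ht : ∀ i, |inner ℝ (c i) v| ≤ 4 * η := by
    intro i
    have h1 : ‖c i‖ ≤ ‖z i‖ + ‖m‖ := norm_sub_le _ _
    calc |inner ℝ (c i) v| ≤ ‖c i‖ * ‖v‖ := abs_real_inner_le_norm _ _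
      _ ≤ (‖z i‖ + ‖m‖) * (2 * ‖m‖) := by
        gcongr
        exact hv4.trans (by gcongr; linarith)
      _ = 2 * (‖m‖ * ‖z i‖) + 2 * ‖m‖ ^ 2 := by ring
      _ ≤ 4 * η := by linarith [hmax i]
  have htsum : ∑ i, inner ℝ (c i) v = 0 := by rw [← sum_inner, hcsum, inner_zero_left]
  refine elLogRatio_le (p := fun i => (1 - inner ℝ (c i) v) / n) ⟨fun i => ⟨?_, ?_⟩, ?_, ?_⟩ ?_
  · have := (abs_le.1 (ht i)).2
    exact div_pos (by linarith) hn0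
  · have := (abs_le.1 (ht i)).1
    rw [div_lt_one hn0]
    linarith
  · rw [← Finset.sum_div, Finset.sum_sub_distrib, htsum]
    simp [hn0.ne']
  · have h1 : ∑ i, ((1 - inner ℝ (c i) v) / n) • z i =
        (n : ℝ)⁻¹ • (∑ i, z i - ∑ i, inner ℝ (c i) v • c i - (∑ i, inner ℝ (c i) v) • m) := by
      rw [Finset.sum_smul, ← Finset.sum_sub_distrib, ← Finset.sum_sub_distrib, Finset.smul_sum]
      refine Finset.sum_congr rfl fun i _ => ?_
      simp only [hc]
      module
    rw [h1, hm, hv, htsum]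
    simp
  · have h1 : ∑ i, (-inner ℝ (c i) v - (1 / 2 + 8 * η) * inner ℝ (c i) v ^ 2) ≤
        ∑ i, Real.log (n * ((1 - inner ℝ (c i) v) / n)) := by
      refine Finset.sum_le_sum fun i _ => ?_
      rw [mul_div_cancel₀ _ hn0.ne', sub_eq_add_neg 1]
      have h := (abs_le.1 (abs_log_one_add_sub_le (a := -inner ℝ (c i) v)
        (by rw [abs_neg]; linarith [ht i]))).1
      rw [abs_neg] at h
      nlinarith [ht i, sq_nonneg (inner ℝ (c i) v)]
    rw [Finset.sum_sub_distrib, Finset.sum_neg_distrib, htsum, ← Finset.mul_sum] at h1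
    have hQ : 0 ≤ n * ‖m‖ ^ 2 := by positivity
    nlinarith [mul_le_mul_of_nonneg_left hsum2 (by linarith : 0 ≤ 1 / 2 + 8 * η), mul_nonneg hQ hη0,
      mul_le_mul_of_nonneg_left hη (mul_nonneg hQ hη0)]

/-! ### Invariance and measurability -/

lemma elWeights_map {n d : ℕ} (g : Fin n → Euc d) (M : Euc d ≃ₗ[ℝ] Euc d) :
    elWeights (fun i => M (g i)) = elWeights g := by
  ext p
  simp only [elWeights, Set.mem_ofPred_eq, ← map_smul, ← map_sum, LinearEquiv.map_eq_zero_iff]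

lemma elLogRatio_map {n d : ℕ} (g : Fin n → Euc d) (M : Euc d ≃ₗ[ℝ] Euc d) :
    elLogRatio (fun i => M (g i)) = elLogRatio g := by
  simp only [elLogRatio, elWeights_map]

/-- Nonnegative weights with total mass one and log-likelihood at least `b`. -/
def elSuperlevel (n : ℕ) (b : ℝ) : Set (Fin n → ℝ) :=
  {p | (∀ i, p i ∈ Set.Icc (0 : ℝ) 1) ∧ ∑ i, p i = 1 ∧ Real.exp b ≤ ∏ i, (n * p i)}

lemma isCompact_elSuperlevel (n : ℕ) (b : ℝ) : IsCompact (elSuperlevel n b) := by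
  have hK : IsCompact (Set.univ.pi fun _ : Fin n => Set.Icc (0 : ℝ) 1) :=
    isCompact_univ_pi fun _ => isCompact_Icc
  have h1 : IsClosed {p : Fin n → ℝ | ∑ i, p i = 1} := isClosed_eq (by fun_prop) continuous_const
  have h2 : IsClosed {p : Fin n → ℝ | Real.exp b ≤ ∏ i, (n * p i)} :=
    isClosed_le continuous_const (by fun_prop)
  convert! hK.inter_right (h1.inter h2) using 1
  ext p
  simp [elSuperlevel, Pi.le_def, forall_and]

/-- The empirical log-likelihood ratio is lower semicontinuous, as its sublevel sets are
projections of closed sets along compact sets of weights; in particular it is measurable. -/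
lemma measurable_elLogRatio (n d : ℕ) : Measurable (elLogRatio (n := n) (d := d)) := by
  -- for `n ≤ 1` there are no admissible weights, as they lie in the open interval `(0, 1)`
  rcases lt_or_ge n 2 with hn | hn
  · have h : ∀ g : Fin n → Euc d, elWeights g = ∅ := by
      intro g
      refine Set.eq_empty_of_forall_notMem fun p hp => ?_
      obtain ⟨h1, h2, -⟩ := hp
      interval_cases n
      · simp at h2
      · simp at h2
        exact absurd h2 (h1 0).2.ne
    have : elLogRatio (n := n) (d := d) = fun _ => ((-2 : ℝ) : EReal) * ⊥ := by
      funext g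
      simp [elLogRatio, h]
    rw [this]
    exact measurable_const
  refine Measurable.const_mul ?_ _
  refine measurable_of_Ioi fun a => ?_
  have key : (fun g : Fin n → Euc d => ⨆ p ∈ elWeights g,
      ((∑ i, Real.log ((n : ℝ) * p i) : ℝ) : EReal)) ⁻¹' Set.Ioi a =
      ⋃ q ∈ {q : ℚ | a < ((q : ℝ) : EReal)}, {g | ∃ p ∈ elSuperlevel n q, ∑ i, p i • g i = 0} := by
    ext g
    simp only [Set.mem_preimage, Set.mem_Ioi, lt_iSup_iff, Set.mem_iUnion, Set.mem_ofPred_eq,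
      exists_prop]
    constructor
    · rintro ⟨p, hp, hap⟩
      obtain ⟨q, hq1, hq2⟩ := EReal.lt_iff_exists_rat_btwn.1 hap
      refine ⟨q, hq1, p, ⟨fun i => ⟨(hp.1 i).1.le, (hp.1 i).2.le⟩, hp.2.1, ?_⟩, hp.2.2⟩
      have hpos : ∀ i, 0 < n * p i := fun i =>
        mul_pos (by exact_mod_cast (by omega : 0 < n)) (hp.1 i).1
      rw [← Real.le_log_iff_exp_le (Finset.prod_pos fun i _ => hpos i),
        Real.log_prod fun i _ => (hpos i).ne']
      exact_mod_cast hq2.le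
    · rintro ⟨q, hq, p, ⟨hp1, hp2, hp3⟩, hpg⟩
      have hprod := (Real.exp_pos _).trans_le hp3
      have hne : ∀ i, n * p i ≠ 0 := fun i => Finset.prod_ne_zero_iff.1 hprod.ne' i (Finset.mem_univ i)
      have hpos : ∀ i, 0 < p i := fun i =>
        lt_of_le_of_ne (hp1 i).1 fun h => hne i (by rw [← h, mul_zero])
      refine ⟨p, ⟨fun i => ⟨hpos i, ?_⟩, hp2, hpg⟩, hq.trans_le ?_⟩
      · have : Nontrivial (Fin n) := Fin.nontrivial_iff_two_le.2 hn
        obtain ⟨j, hj⟩ := exists_ne i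
        calc p i < p i + p j := by linarith [hpos j]
          _ ≤ ∑ k, p k := by
            rw [← Finset.sum_pair hj.symm]
            exact Finset.sum_le_sum_of_subset_of_nonneg (Finset.subset_univ _)
              fun k _ _ => (hpos k).le
          _ = 1 := hp2
      · rw [← Real.le_log_iff_exp_le hprod, Real.log_prod fun i _ => hne i] at hp3
        exact_mod_cast hp3
  rw [key]
  refine MeasurableSet.biUnion (Set.to_countable _) fun q _ => IsClosed.measurableSet ?_
  have hK : CompactSpace (elSuperlevel n q) :=
    isCompact_iff_compactSpace.1 (isCompact_elSuperlevel n q)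
  have hC : IsClosed {x : (Fin n → Euc d) × elSuperlevel n q | ∑ i, x.2.1 i • x.1 i = 0} := by
    refine isClosed_eq (continuous_finsetSum _ fun i _ => ?_) continuous_const
    exact ((continuous_apply i).comp (continuous_subtype_val.comp continuous_snd)).smul
      ((continuous_apply i).comp continuous_fst)
  convert! isClosedMap_fst_of_compactSpace _ hC using 1
  ext g
  simp [and_comm]

/-! ### Convergence in distribution and in probability -/

section Convergence

variable {Ω Ω' : Type*} [MeasurableSpace Ω] {P : Measure Ω} [IsProbabilityMeasure P]
  [MeasurableSpace Ω'] {P' : Measure Ω'} [IsProbabilityMeasure P']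

/-- Convergence in distribution is unaffected by changes on events of vanishing probability. -/
lemma MeasureTheory.TendstoInDistribution.of_measure_ne_tendsto_zero {E : Type*}
    [TopologicalSpace E] [MeasurableSpace E] [BorelSpace E] {U V : ℕ → Ω → E} {Z : Ω' → E}
    (hU : TendstoInDistribution U atTop Z (fun _ => P) P') (hV : ∀ n, Measurable (V n))
    (h : Tendsto (fun n => P {ω | U n ω ≠ V n ω}) atTop (𝓝 0)) :
    TendstoInDistribution V atTop Z (fun _ => P) P' where
  forall_aemeasurable n := (hV n).aemeasurable
  aemeasurable_limit := hU.aemeasurable_limit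
  tendsto := by
    have hUm := hU.forall_aemeasurable
    have h1 := ProbabilityMeasure.tendsto_iff_forall_integral_tendsto.1 hU.tendsto
    refine ProbabilityMeasure.tendsto_iff_forall_integral_tendsto.2 fun F => ?_
    have h2 : Tendsto (fun n => ∫ ω, F (V n ω) ∂P - ∫ ω, F (U n ω) ∂P) atTop (𝓝 0) := by
      have h3 : Tendsto (fun n => 2 * ‖F‖ * P.real {ω | U n ω ≠ V n ω}) atTop (𝓝 0) := by
        simpa [Measure.real] using
          ((ENNReal.tendsto_toReal ENNReal.zero_ne_top).comp h).const_mul (2 * ‖F‖)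
      refine squeeze_zero_norm (fun n => ?_) h3
      have hiV : Integrable (fun ω => F (V n ω)) P :=
        Integrable.of_bound (F.continuous.measurable.comp (hV n)).aestronglyMeasurable ‖F‖
          (ae_of_all _ fun ω => F.norm_coe_le_norm _)
      have hiU : Integrable (fun ω => F (U n ω)) P :=
        Integrable.of_bound
          (F.continuous.measurable.comp_aemeasurable (hUm n)).aestronglyMeasurable ‖F‖
          (ae_of_all _ fun ω => F.norm_coe_le_norm _)
      rw [← integral_sub hiV hiU]
      set S := toMeasurable P {ω | U n ω ≠ V n ω} with hS
      have hSm : MeasurableSet S := measurableSet_toMeasurable _ _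
      have hle : ∀ ω, ‖F (V n ω) - F (U n ω)‖ ≤ S.indicator (fun _ => 2 * ‖F‖) ω := by
        intro ω
        by_cases hω : ω ∈ S
        · rw [Set.indicator_of_mem hω]
          have := norm_sub_le (F (V n ω)) (F (U n ω))
          linarith [F.norm_coe_le_norm (V n ω), F.norm_coe_le_norm (U n ω)]
        · have : U n ω = V n ω := by
            by_contra hne
            exact hω (subset_toMeasurable _ _ hne)
          simp [Set.indicator_of_notMem hω, this]
      refine (norm_integral_le_of_norm_le ((integrable_const _).indicator hSm)
        (ae_of_all _ hle)).trans (le_of_eq ?_)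
      rw [integral_indicator_const _ hSm, hS, Measure.real, Measure.real, measure_toMeasurable,
        smul_eq_mul, mul_comm]
    have h3 := (h1 F).add h2
    simp only [ProbabilityMeasure.coe_mk] at h3 ⊢
    rw [add_zero] at h3
    refine h3.congr fun n => ?_
    rw [integral_map (hUm n) F.continuous.measurable.aestronglyMeasurable,
      integral_map (hV n).aemeasurable F.continuous.measurable.aestronglyMeasurable]
    ring

/-- An extended real statistic which is within every `ε` of a real statistic `Q n`, up to events of
vanishing probability, has the same limit law as `Q n`. -/
lemma MeasureTheory.TendstoInDistribution.ereal_of_near {Q : ℕ → Ω → ℝ} {l : ℕ → Ω → EReal}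
    {Z : Ω' → ℝ} (hQ : TendstoInDistribution Q atTop Z (fun _ => P) P')
    (hl : ∀ n, Measurable (l n))
    (h : ∀ ε > 0, Tendsto (fun n => P {ω | ¬ (((Q n ω - ε : ℝ) : EReal) < l n ω ∧
      l n ω < ((Q n ω + ε : ℝ) : EReal))}) atTop (𝓝 0)) :
    TendstoInDistribution l atTop (fun ω => (Z ω : EReal)) (fun _ => P) P' := by
  have hL : TendstoInDistribution (fun n ω => (l n ω).toReal) atTop Z (fun _ => P) P' := by
    refine tendstoInDistribution_of_tendstoInMeasure_sub _ _ hQ ?_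
      fun n => (hl n).ereal_toReal.aemeasurable
    rw [tendstoInMeasure_iff_norm]
    intro ε hε
    refine tendsto_of_tendsto_of_tendsto_of_le_of_le tendsto_const_nhds (h ε hε)
      (fun _ => zero_le) fun n => measure_mono fun ω hω => ?_
    rintro ⟨h1, h2⟩
    have hω : ε ≤ ‖(l n ω).toReal - Q n ω - 0‖ := hω
    lift l n ω to ℝ using ⟨(h2.trans (EReal.coe_lt_top _)).ne, ((EReal.bot_lt_coe _).trans h1).ne'⟩
      with x
    rw [EReal.toReal_coe, sub_zero, Real.norm_eq_abs] at hω
    rw [EReal.coe_lt_coe_iff] at h1 h2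
    exact absurd hω (not_le.2 (abs_lt.2 ⟨by linarith, by linarith⟩))
  refine (hL.continuous_comp continuous_coe_real_ereal).of_measure_ne_tendsto_zero hl ?_
  refine tendsto_of_tendsto_of_tendsto_of_le_of_le tendsto_const_nhds (h 1 one_pos)
      (fun _ => zero_le) fun n => measure_mono fun ω hω => ?_
  rintro ⟨h1, h2⟩
  exact hω (EReal.coe_toReal (h2.trans (EReal.coe_lt_top _)).ne
    ((EReal.bot_lt_coe _).trans h1).ne')

/-- Convergence in distribution to zero implies convergence to zero in probability. -/
lemma tendsto_measure_ge_of_tendstoInDistribution_zero {T : ℕ → Ω → ℝ}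
    (hT : TendstoInDistribution T atTop (fun _ : Ω' => (0 : ℝ)) (fun _ => P) P') {ε : ℝ}
    (hε : 0 < ε) : Tendsto (fun n => P {ω | ε ≤ T n ω}) atTop (𝓝 0) := by
  have hTm := hT.forall_aemeasurable
  have h := ProbabilityMeasure.tendsto_measure_of_null_frontier_of_tendsto' hT.tendsto
    (E := Set.Ici ε) (by simp [hε.ne'])
  simp only [ProbabilityMeasure.coe_mk] at h
  have h0 : (P'.map fun _ => (0 : ℝ)) (Set.Ici ε) = 0 := by simp [hε]
  rw [h0] at h
  refine h.congr fun n => ?_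
  rw [Measure.map_apply_of_aemeasurable (hTm n) measurableSet_Ici]
  rfl

end Convergence

/-- If the averages of `aᵢ²` converge then `max_{i < n} aᵢ = o(√n)`. -/
lemma eventually_forall_le_mul_sqrt {a : ℕ → ℝ} {L : ℝ}
    (h : Tendsto (fun n : ℕ => (∑ i ∈ Finset.range n, a i ^ 2) / n) atTop (𝓝 L)) {ε : ℝ}
    (hε : 0 < ε) : ∀ᶠ n : ℕ in atTop, ∀ i < n, a i ≤ ε * √n := by
  have h1 : Tendsto (fun n : ℕ => a n ^ 2 / ((n : ℝ) + 1)) atTop (𝓝 0) := by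
    have h2 := (h.comp (tendsto_add_atTop_nat 1)).sub
      (h.mul (tendsto_natCast_div_add_atTop (1 : ℝ)))
    rw [mul_one, sub_self] at h2
    refine h2.congr' ?_
    filter_upwards [eventually_gt_atTop 0] with n hn
    have : (n : ℝ) ≠ 0 := by exact_mod_cast hn.ne'
    simp only [Function.comp_apply, Finset.sum_range_succ, Nat.cast_add, Nat.cast_one]
    field_simp
    ring
  obtain ⟨N, hN⟩ := eventually_atTop.1 (h1.eventually (ge_mem_nhds (show 0 < ε ^ 2 by positivity)))
  have h3 : Tendsto (fun n : ℕ => ε * √n) atTop atTop :=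
    (Real.tendsto_sqrt_atTop.comp tendsto_natCast_atTop_atTop).const_mul_atTop hε
  filter_upwards [h3.eventually_ge_atTop (∑ i ∈ Finset.range N, |a i|)] with n hn i hi
  rcases lt_or_ge i N with hiN | hiN
  · exact (le_abs_self _).trans ((Finset.single_le_sum (f := fun i => |a i|)
      (fun _ _ => abs_nonneg _) (Finset.mem_range.2 hiN)).trans hn)
  · have h4 := hN i hiN
    rw [div_le_iff₀ (by positivity)] at h4
    refine abs_le_of_sq_le_sq' ?_ (by positivity) |>.2
    rw [mul_pow, Real.sq_sqrt (by positivity)]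
    have : (i : ℝ) + 1 ≤ n := by exact_mod_cast hi
    exact h4.trans (by gcongr)

/-- The maximum of the norms of the first `n` terms, with value `0` for `n = 0`. -/
noncomputable def maxNorm {E : Type*} [NormedAddCommGroup E] (z : ℕ → E) (n : ℕ) : ℝ :=
  ((Finset.range n).sup fun i => ‖z i‖₊ : NNReal)

lemma norm_le_maxNorm {E : Type*} [NormedAddCommGroup E] (z : ℕ → E) {n i : ℕ} (hi : i < n) :
    ‖z i‖ ≤ maxNorm z n :=
  NNReal.coe_le_coe.2 (Finset.le_sup (f := fun i => ‖z i‖₊) (Finset.mem_range.2 hi))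

lemma maxNorm_nonneg {E : Type*} [NormedAddCommGroup E] (z : ℕ → E) (n : ℕ) :
    0 ≤ maxNorm z n := NNReal.coe_nonneg _

lemma maxNorm_le {E : Type*} [NormedAddCommGroup E] {z : ℕ → E} {n : ℕ} {c : ℝ} (hc : 0 ≤ c)
    (h : ∀ i < n, ‖z i‖ ≤ c) : maxNorm z n ≤ c := by
  lift c to NNReal using hc
  exact NNReal.coe_le_coe.2 (Finset.sup_le fun i hi => h i (Finset.mem_range.1 hi))

lemma measurable_maxNorm {Ω E : Type*} [MeasurableSpace Ω] [NormedAddCommGroup E]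
    [MeasurableSpace E] [OpensMeasurableSpace E] {z : ℕ → Ω → E} (hz : ∀ i, Measurable (z i))
    (n : ℕ) : Measurable fun ω => maxNorm (fun i => z i ω) n := by
  refine Measurable.coe_nnreal_real ?_
  induction n with
  | zero => simp
  | succ n ih =>
    simp only [Finset.range_add_one, Finset.sup_insert]
    exact (hz n).nnnorm.sup ih

lemma tendsto_maxNorm_div_sqrt {E : Type*} [NormedAddCommGroup E] {z : ℕ → E} {L : ℝ}
    (h : Tendsto (fun n : ℕ => (∑ i ∈ Finset.range n, ‖z i‖ ^ 2) / n) atTop (𝓝 L)) :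
    Tendsto (fun n : ℕ => maxNorm z n / √n) atTop (𝓝 0) := by
  rw [Metric.tendsto_nhds]
  intro ε hε
  filter_upwards [eventually_forall_le_mul_sqrt h (half_pos hε), eventually_gt_atTop 0]
    with n hn hn0
  have hs : 0 < √(n : ℝ) := Real.sqrt_pos.2 (by exact_mod_cast hn0)
  rw [Real.dist_eq, sub_zero, abs_of_nonneg (div_nonneg (maxNorm_nonneg _ _) hs.le),
    div_lt_iff₀ hs]
  exact (maxNorm_le (by positivity) hn).trans_lt (by gcongr; linarith)

/-! ### The empirical likelihood of an i.i.d. sample -/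

section IID

variable {Ω : Type*} [MeasurableSpace Ω] {P : Measure Ω} {d : ℕ}

lemma inner_eq_sum_mul (x t : Euc d) : inner ℝ x t = ∑ j, t j * x j := by
  simp [PiLp.inner_apply]

lemma norm_sq_eq_sum_mul (x : Euc d) : ‖x‖ ^ 2 = ∑ j, x j * x j := by
  simp [EuclideanSpace.real_norm_sq_eq, ← sq]

lemma inner_sq_eq_sum (x t : Euc d) :
    inner ℝ x t ^ 2 = ∑ j, ∑ k, t j * t k * (x j * x k) := by
  rw [inner_eq_sum_mul, sq, Finset.sum_mul_sum]
  exact Finset.sum_congr rfl fun j _ => Finset.sum_congr rfl fun k _ => by ring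

lemma integral_inner_sq {w : Ω → Euc d} (hL2 : ∀ j, MemLp (fun ω => w ω j) 2 P) (t : Euc d) :
    ∫ ω, inner ℝ (w ω) t ^ 2 ∂P = ∑ j, ∑ k, t j * t k * ∫ ω, w ω j * w ω k ∂P := by
  have hi : ∀ j k, Integrable (fun ω => t j * t k * (w ω j * w ω k)) P := fun j k =>
    ((hL2 j).integrable_mul (hL2 k)).const_mul _
  simp only [inner_sq_eq_sum]
  rw [integral_finsetSum _ fun j _ => integrable_finsetSum _ fun k _ => hi j k]
  refine Finset.sum_congr rfl fun j _ => ?_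
  rw [integral_finsetSum _ fun k _ => hi j k]
  exact Finset.sum_congr rfl fun k _ => integral_const_mul _ _

lemma integral_inner_eq_sum {w : Ω → Euc d} (hi : ∀ j, Integrable (fun ω => w ω j) P) (t : Euc d) :
    ∫ ω, inner ℝ (w ω) t ∂P = ∑ j, t j * ∫ ω, w ω j ∂P := by
  simp only [inner_eq_sum_mul]
  rw [integral_finsetSum _ fun j _ => (hi j).const_mul _]
  exact Finset.sum_congr rfl fun k _ => integral_const_mul _ _

variable [IsProbabilityMeasure P]

/-- The central limit theorem for isotropic random vectors. -/
theorem tendstoInDistribution_inv_sqrt_smul_sum {z : ℕ → Ω → Euc d} (hz : ∀ i, Measurable (z i))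
    (hind : iIndepFun z P) (hid : ∀ i, IdentDistrib (z i) (z 0) P P)
    (hL2 : ∀ j, MemLp (fun ω => z 0 ω j) 2 P) (hmean : ∀ j, ∫ ω, z 0 ω j ∂P = 0)
    (hcov : ∀ j k, ∫ ω, z 0 ω j * z 0 ω k ∂P = if j = k then 1 else 0) :
    TendstoInDistribution (fun (n : ℕ) ω => (√n)⁻¹ • ∑ i ∈ Finset.range n, z i ω) atTop
      (WithLp.toLp 2 : (Fin d → ℝ) → Euc d) (fun _ => P)
      (Measure.pi fun _ : Fin d => gaussianReal 0 1) where
  forall_aemeasurable n := by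
    have := fun i => hz i
    fun_prop
  tendsto := by
    refine ProbabilityMeasure.tendsto_iff_tendsto_charFun.2 fun t => ?_
    simp only [ProbabilityMeasure.coe_mk]
    rw [map_pi_eq_stdGaussian, charFun_stdGaussian]
    have hmemt : MemLp (fun ω => inner ℝ (z 0 ω) t) 2 P := by
      simp only [inner_eq_sum_mul]
      exact memLp_finsetSum _ fun j _ => (hL2 j).const_mul _
    have h0 : ∫ ω, inner ℝ (z 0 ω) t ∂P = 0 := by
      rw [integral_inner_eq_sum fun j => (hL2 j).integrable one_le_two]
      simp [hmean]
    have h1 : Var[fun ω => inner ℝ (z 0 ω) t; P] = ‖t‖ ^ 2 := by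
      rw [variance_eq_integral hmemt.aestronglyMeasurable.aemeasurable, h0]
      simp only [sub_zero]
      rw [integral_inner_sq hL2]
      simp [hcov, norm_sq_eq_sum_mul]
    have hclt := tendstoInDistribution_inv_sqrt_mul_sum_sub
      (X := fun i ω => inner ℝ (z i ω) t) (P := P)
      (Y := id) (P' := gaussianReal 0 Var[fun ω => inner ℝ (z 0 ω) t; P].toNNReal)
      HasLaw.id hmemt
      (hind.comp (fun _ x => inner ℝ x t) fun _ => by fun_prop)
      (fun i => (hid i).comp (u := fun x => inner ℝ x t) (by fun_prop))
    have h2 := ProbabilityMeasure.tendsto_iff_tendsto_charFun.1 hclt.tendsto 1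
    simp only [ProbabilityMeasure.coe_mk, Measure.map_id, charFun_gaussianReal, h1, h0] at h2
    have e1 : Complex.exp (-(‖t‖ : ℂ) ^ 2 / 2) =
        Complex.exp (((1 : ℝ) : ℂ) * ((0 : ℝ) : ℂ) * Complex.I -
          (((‖t‖ ^ 2).toNNReal : ℝ) : ℂ) * ((1 : ℝ) : ℂ) ^ 2 / 2) := by
      rw [Real.coe_toNNReal _ (sq_nonneg _)]
      congr 1
      push_cast
      ring
    rw [e1]
    refine h2.congr fun n => ?_
    have hzn := fun i => hz i
    rw [charFun_apply_real, charFun_apply, integral_map (by fun_prop) (by fun_prop),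
      integral_map (by fun_prop) (by fun_prop)]
    simp [inner_smul_left, sum_inner]

/-- Wilks' phenomenon for the empirical likelihood of the mean of isotropic random vectors. -/
theorem tendstoInDistribution_elLogRatio_of_isotropic {z : ℕ → Ω → Euc d}
    (hz : ∀ i, Measurable (z i))
    (hind : iIndepFun z P) (hid : ∀ i, IdentDistrib (z i) (z 0) P P)
    (hL2 : ∀ j, MemLp (fun ω => z 0 ω j) 2 P) (hmean : ∀ j, ∫ ω, z 0 ω j ∂P = 0)
    (hcov : ∀ j k, ∫ ω, z 0 ω j * z 0 ω k ∂P = if j = k then 1 else 0) :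
    TendstoInDistribution (fun n ω => elLogRatio fun i : Fin n => z i ω) atTop
      (fun x => ((‖(WithLp.toLp 2 x : Euc d)‖ ^ 2 : ℝ) : EReal)) (fun _ => P)
      (Measure.pi fun _ : Fin d => gaussianReal 0 1) := by
  set W : ℕ → Ω → Euc d := fun n ω => (√n)⁻¹ • ∑ i ∈ Finset.range n, z i ω with hWdef
  have hW := tendstoInDistribution_inv_sqrt_smul_sum hz hind hid hL2 hmean hcov
  change TendstoInDistribution W _ _ _ _ at hW
  -- the deviation of the empirical second moments from the identity
  set R : ℕ → Ω → ℝ := fun n ω => ∑ j, ∑ k,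
    |(∑ i ∈ Finset.range n, z i ω j * z i ω k) / n - if j = k then 1 else 0| with hR
  set M : ℕ → Ω → ℝ := fun n ω => maxNorm (fun i => z i ω) n / √n with hM
  have hmeas : ∀ i j, Measurable fun ω => z i ω j := fun i j => by
    have := hz i
    fun_prop
  have hRm : ∀ n, Measurable (R n) := fun n => by fun_prop
  have hMm : ∀ n, Measurable (M n) := fun n => (measurable_maxNorm hz n).div_const _
  have hpair : Pairwise fun i j => IndepFun (z i) (z j) P := fun i j hij => hind.indepFun hij
  have hprod : ∀ j k, ∀ᵐ ω ∂P, Tendsto (fun n : ℕ =>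
      (∑ i ∈ Finset.range n, z i ω j * z i ω k) / (n : ℝ)) atTop (𝓝 (if j = k then 1 else 0)) := by
    intro j k
    have hu : Measurable fun x : Euc d => x j * x k := by fun_prop
    have h := strong_law_ae_real (μ := P) (fun i ω => z i ω j * z i ω k)
      ((hL2 j).integrable_mul (hL2 k)) (fun i i' hii => (hpair hii).comp hu hu)
      (fun i => (hid i).comp hu)
    rwa [hcov] at h
  have hRlim : ∀ᵐ ω ∂P, Tendsto (fun n => R n ω) atTop (𝓝 0) := by
    filter_upwards [ae_all_iff.2 fun j => ae_all_iff.2 fun k => hprod j k] with ω hω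
    have h := tendsto_finsetSum Finset.univ fun j _ => tendsto_finsetSum Finset.univ fun k _ =>
      ((hω j k).sub_const (if j = k then 1 else 0)).abs
    simpa using h
  have hMlim : ∀ᵐ ω ∂P, Tendsto (fun n => M n ω) atTop (𝓝 0) := by
    filter_upwards [ae_all_iff.2 fun j => hprod j j] with ω hω
    have h := tendsto_finsetSum Finset.univ fun j _ => hω j
    refine tendsto_maxNorm_div_sqrt (h.congr fun n => ?_)
    rw [← Finset.sum_div, Finset.sum_comm]
    simp [norm_sq_eq_sum_mul]
  have hRM : TendstoInMeasure P (fun n ω => (R n ω, M n ω)) atTop fun _ => ((0, 0) : ℝ × ℝ) := by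
    refine tendstoInMeasure_of_tendsto_ae
      (fun n => ((hRm n).prodMk (hMm n)).aestronglyMeasurable) ?_
    filter_upwards [hRlim, hMlim] with ω h1 h2
    exact h1.prodMk_nhds h2
  -- `η = R + ‖W‖ M` controls the approximation of the ratio by `‖W‖²`; the second factor makes
  -- smallness of the product imply both `η ≤ 1 / 8` and `28 η ‖W‖² < ε`
  have hT := hW.continuous_comp_prodMk_of_tendstoInMeasure_const
    (g := fun x : Euc d × ℝ × ℝ => (x.2.1 + ‖x.1‖ * x.2.2) * (8 + 56 * ‖x.1‖ ^ 2))
    (by fun_prop) hRM fun n => ((hRm n).prodMk (hMm n)).aemeasurable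
  simp only [mul_zero, add_zero, zero_mul] at hT
  refine (hW.continuous_comp (g := fun x => ‖x‖ ^ 2) (by fun_prop)).ereal_of_near
    (fun n => (measurable_elLogRatio n d).comp (measurable_pi_lambda _ fun i => hz i))
    fun ε hε => ?_
  refine tendsto_of_tendsto_of_tendsto_of_le_of_le' tendsto_const_nhds
    (tendsto_measure_ge_of_tendstoInDistribution_zero hT (ε := min 1 ε) (by positivity))
    (Eventually.of_forall fun _ => zero_le) ?_
  filter_upwards [eventually_ge_atTop 2] with n hn
  refine measure_mono fun ω hω => ?_
  by_contra hcon
  simp only [Set.mem_ofPred_eq, not_le, lt_min_iff] at hcon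
  refine hω ?_
  obtain ⟨hc1, hc2⟩ := hcon
  have hn0 : (0 : ℝ) < n := by exact_mod_cast (by omega : 0 < n)
  have hs : 0 < √(n : ℝ) := Real.sqrt_pos.2 hn0
  have hR0 : 0 ≤ R n ω :=
    Finset.sum_nonneg fun _ _ => Finset.sum_nonneg fun _ _ => abs_nonneg _
  have hM0 : 0 ≤ M n ω := div_nonneg (maxNorm_nonneg _ _) hs.le
  set η := R n ω + ‖W n ω‖ * M n ω with hη
  have hη0 : 0 ≤ η := by positivity
  have hη8 : η ≤ 1 / 8 := by nlinarith [mul_nonneg hη0 (sq_nonneg ‖W n ω‖)]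
  set m : Euc d := (√n)⁻¹ • W n ω with hmdef
  have hnm : (n : ℝ) * ‖m‖ ^ 2 = ‖W n ω‖ ^ 2 := by
    rw [hmdef, norm_smul, norm_inv, Real.norm_eq_abs, abs_of_pos hs, mul_pow, inv_pow,
      Real.sq_sqrt hn0.le, mul_inv_cancel_left₀ hn0.ne']
  have hm : ∑ i : Fin n, z i ω = (n : ℝ) • m := by
    rw [hmdef, hWdef, smul_smul, smul_smul, Fin.sum_univ_eq_sum_range (fun i => z i ω) n]
    have : (n : ℝ) * ((√n)⁻¹ * (√n)⁻¹) = 1 := by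
      rw [← mul_inv, Real.mul_self_sqrt hn0.le, mul_inv_cancel₀ hn0.ne']
    rw [mul_assoc, this, one_smul]
  have hS : ∀ x, |∑ i : Fin n, inner ℝ (z i ω) x ^ 2 - n * ‖x‖ ^ 2| ≤ n * η * ‖x‖ ^ 2 := by
    intro x
    have h1 : ∑ i : Fin n, inner ℝ (z i ω) x ^ 2 - n * ‖x‖ ^ 2 =
        n * ∑ j, ∑ k, x j * x k * ((∑ i ∈ Finset.range n, z i ω j * z i ω k) / n -
          if j = k then 1 else 0) := by
      rw [Fin.sum_univ_eq_sum_range (fun i => inner ℝ (z i ω) x ^ 2) n]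
      simp only [mul_sub, Finset.sum_sub_distrib, inner_sq_eq_sum]
      congr 1
      · rw [Finset.sum_comm, Finset.mul_sum]
        refine Finset.sum_congr rfl fun j _ => ?_
        rw [Finset.sum_comm, Finset.mul_sum]
        refine Finset.sum_congr rfl fun k _ => ?_
        rw [← Finset.mul_sum]
        field_simp
      · simp [norm_sq_eq_sum_mul]
    rw [h1, abs_mul, abs_of_pos hn0, mul_assoc]
    refine mul_le_mul_of_nonneg_left ?_ hn0.le
    calc _ ≤ ∑ j, ∑ k, |x j * x k * ((∑ i ∈ Finset.range n, z i ω j * z i ω k) / n -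
          if j = k then 1 else 0)| := (Finset.abs_sum_le_sum_abs _ _).trans
            (Finset.sum_le_sum fun j _ => Finset.abs_sum_le_sum_abs _ _)
      _ ≤ ∑ j, ∑ k, |(∑ i ∈ Finset.range n, z i ω j * z i ω k) / n -
          if j = k then 1 else 0| * ‖x‖ ^ 2 := by
        refine Finset.sum_le_sum fun j _ => Finset.sum_le_sum fun k _ => ?_
        rw [abs_mul, abs_mul, mul_comm, sq]
        have hx : ∀ j, |x j| ≤ ‖x‖ := fun j => PiLp.norm_apply_le x j
        gcongr
        · exact hx j
        · exact hx k
      _ = R n ω * ‖x‖ ^ 2 := by simp only [hR, Finset.sum_mul]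
      _ ≤ η * ‖x‖ ^ 2 := by
        gcongr
        exact le_add_of_nonneg_right (by positivity)
  have hmax : ∀ i : Fin n, ‖m‖ * ‖z i ω‖ ≤ η := by
    intro i
    calc ‖m‖ * ‖z i ω‖ ≤ ‖m‖ * maxNorm (fun i => z i ω) n := by
          gcongr
          exact norm_le_maxNorm (fun i => z i ω) i.2
      _ = ‖W n ω‖ * M n ω := by
          rw [hmdef, norm_smul, norm_inv, Real.norm_eq_abs, abs_of_pos hs, hM]
          ring
      _ ≤ η := le_add_of_nonneg_left hR0
  have hlow := le_elLogRatio_of_near_isotropic hη8 hm hS hmax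
  have hup := elLogRatio_le_of_near_isotropic hn hη8 hm hS hmax
  rw [hnm] at hlow hup
  have hsmall : 28 * η * ‖W n ω‖ ^ 2 < ε := by nlinarith [mul_nonneg hη0 (sq_nonneg ‖W n ω‖)]
  constructor
  · refine lt_of_lt_of_le ?_ hlow
    rw [EReal.coe_lt_coe_iff]
    simp only [Function.comp_apply]
    linarith
  · refine lt_of_le_of_lt hup ?_
    rw [EReal.coe_lt_coe_iff]
    simp only [Function.comp_apply]
    linarith

end IID

/-! ### Whitening and Owen's theorem -/

section Whitening

variable {Ω : Type*} [MeasurableSpace Ω] {P : Measure Ω} {d : ℕ}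

open scoped MatrixOrder in
/-- Whitening: a positive definite matrix `A` is reduced to the identity by a congruence. -/
lemma Matrix.PosDef.exists_mul_mul_transpose_eq_one {A : Matrix (Fin d) (Fin d) ℝ}
    (hA : A.PosDef) : ∃ B : Matrix (Fin d) (Fin d) ℝ, IsUnit B.det ∧ B * A * B.transpose = 1 := by
  obtain ⟨B, hB⟩ := CStarAlgebra.nonneg_iff_eq_star_mul_self.mp hA.inv.posSemidef.nonneg
  have hAu : IsUnit A.det := (Matrix.isUnit_iff_isUnit_det _).1 hA.isUnit
  rw [Matrix.star_eq_conjTranspose, Matrix.conjTranspose_eq_transpose_of_trivial] at hB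
  have h1 : A * (B.transpose * B) = 1 := by rw [← hB, Matrix.mul_nonsing_inv _ hAu]
  have h2 : B * (A * B.transpose) = 1 := by
    rw [mul_eq_one_comm, Matrix.mul_assoc, h1]
  exact ⟨B, Matrix.isUnit_det_of_right_inverse h2, by rw [Matrix.mul_assoc, h2]⟩

/-- **Owen's theorem**: for an i.i.d. sample of centred, square integrable random vectors with
positive definite covariance matrix, the empirical log-likelihood ratio for the mean converges in
distribution to the chi-squared law. -/
theorem tendstoInDistribution_elLogRatio [IsProbabilityMeasure P] {g : ℕ → Ω → Euc d}
    (hg : ∀ i, Measurable (g i))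
    (hind : iIndepFun g P) (hid : ∀ i, IdentDistrib (g i) (g 0) P P)
    (hL2 : ∀ j, MemLp (fun ω => g 0 ω j) 2 P) (hmean : ∀ j, ∫ ω, g 0 ω j ∂P = 0)
    (hcov : (Matrix.of fun j k => ∫ ω, g 0 ω j * g 0 ω k ∂P).PosDef) :
    TendstoInDistribution (fun n ω => elLogRatio fun i : Fin n => g i ω) atTop
      (fun t : ℝ => (t : EReal)) (fun _ => P) (chiSquared d) := by
  obtain ⟨B, hBu, hB⟩ := hcov.exists_mul_mul_transpose_eq_one
  have hinj : Function.Injective (Matrix.toEuclideanLin B) := by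
    intro x y hxy
    have h := Matrix.mulVec_injective_iff_isUnit.2 ((Matrix.isUnit_iff_isUnit_det _).2 hBu)
    have h2 : B.mulVec x.ofLp = B.mulVec y.ofLp := by
      simpa [Matrix.toLpLin_apply] using hxy
    exact WithLp.ofLp_injective 2 (h h2)
  set M : Euc d ≃ₗ[ℝ] Euc d := LinearEquiv.ofInjectiveEndo (Matrix.toEuclideanLin B) hinj with hMdef
  have hMx : ∀ x j, M x j = ∑ a, B j a * x a := by
    intro x j
    simp [hMdef, Matrix.toLpLin_apply, Matrix.mulVec, dotProduct]
  have hMm : Measurable M := M.toLinearMap.continuous_of_finiteDimensional.measurable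
  have hlim := tendstoInDistribution_elLogRatio_of_isotropic (P := P) (z := fun i ω => M (g i ω))
    (fun i => hMm.comp (hg i)) (hind.comp (fun _ => M) fun _ => hMm) (fun i => (hid i).comp hMm)
    (fun j => by
      simp only [hMx]
      exact memLp_finsetSum _ fun a _ => (hL2 a).const_mul _)
    (fun j => by
      simp only [hMx]
      rw [integral_finsetSum _ fun a _ => ((hL2 a).integrable one_le_two).const_mul _]
      simp [integral_const_mul, hmean])
    (fun j k => by
      have h1 : ∀ ω, M (g 0 ω) j * M (g 0 ω) k =
          ∑ b, ∑ a, B j a * B k b * (g 0 ω a * g 0 ω b) := by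
        intro ω
        rw [hMx, hMx, Finset.sum_mul_sum, Finset.sum_comm]
        exact Finset.sum_congr rfl fun b _ => Finset.sum_congr rfl fun a _ => by ring
      have hi : ∀ a b, Integrable (fun ω => B j a * B k b * (g 0 ω a * g 0 ω b)) P :=
        fun a b => ((hL2 a).integrable_mul (hL2 b)).const_mul _
      simp only [h1]
      rw [integral_finsetSum _ fun b _ => integrable_finsetSum _ fun a _ => hi a b,
        ← Matrix.one_apply, ← hB, Matrix.mul_apply]
      refine Finset.sum_congr rfl fun b _ => ?_
      rw [integral_finsetSum _ fun a _ => hi a b, Matrix.mul_apply, Finset.sum_mul]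
      refine Finset.sum_congr rfl fun a _ => ?_
      rw [integral_const_mul, Matrix.of_apply, Matrix.transpose_apply]
      ring)
  simp only [elLogRatio_map] at hlim
  refine ⟨hlim.forall_aemeasurable, measurable_coe_real_ereal.aemeasurable, ?_⟩
  have hmap : (chiSquared d).map (fun t : ℝ => (t : EReal)) =
      (Measure.pi fun _ : Fin d => gaussianReal 0 1).map
        fun x => ((‖(WithLp.toLp 2 x : Euc d)‖ ^ 2 : ℝ) : EReal) := by
    unfold chiSquared
    rw [Measure.map_map measurable_coe_real_ereal (by fun_prop)]
    congr 1
    funext x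
    simp [EuclideanSpace.real_norm_sq_eq]
  convert! hlim.tendsto using 2
  exact congrArg 𝓝 (Subtype.ext hmap)

end Whitening

/-! ### Regularity of the regression function -/

lemma Real.measurable_sign : Measurable Real.sign :=
  Measurable.ite measurableSet_Iio measurable_const
    (Measurable.ite measurableSet_Ioi measurable_const measurable_const)

lemma ContinuousOn.measurable_indicator {α : Type*} [TopologicalSpace α] [MeasurableSpace α]
    [OpensMeasurableSpace α] {h : α → ℝ} {s : Set α} (hh : ContinuousOn h s)
    (hs : MeasurableSet s) : Measurable (s.indicator h) := by
  classical
  rw [← Set.piecewise_eq_indicator]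
  exact hh.measurable_piecewise continuousOn_const hs

section Gradient

variable {p d : ℕ} {Υ : Set (Euc p)} {Γ : Set (Euc d)} {f : Euc p → Euc d → ℝ} {β₀ : Euc d}

lemma AssumptionH2.hasGradientAt (hH2 : AssumptionH2 Υ Γ f) (hβ : β₀ ∈ interior Γ) {x : Euc p}
    (hx : x ∈ Υ) : HasGradientAt (f x) (gradBeta f x β₀) β₀ := by
  obtain ⟨h', hh', -⟩ := hH2.1 x hx
  have h := (hh' β₀ (interior_subset hβ)).hasFDerivWithinAt.hasFDerivAt
    (mem_interior_iff_mem_nhds.1 hβ)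
  exact h.differentiableAt.hasGradientAt

/-- On the covariate space, the gradient in the parameter is a limit of difference quotients that
are continuous in the covariate. -/
lemma AssumptionH2.measurable_indicator_gradBeta (hH2 : AssumptionH2 Υ Γ f)
    (hβ : β₀ ∈ interior Γ) (hΥ : MeasurableSet Υ) :
    Measurable (Υ.indicator fun x => gradBeta f x β₀) := by
  have hcoord : ∀ j, Measurable fun x => (Υ.indicator (fun x => gradBeta f x β₀) x) j := by
    intro j
    set v : Euc d := EuclideanSpace.single j 1
    have hlim : Tendsto (fun n : ℕ => β₀ + (n : ℝ)⁻¹ • v) atTop (𝓝 β₀) := by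
      simpa using (tendsto_inv_atTop_nhds_zero_nat (𝕜 := ℝ)).smul_const v |>.const_add β₀
    obtain ⟨N, hN⟩ := eventually_atTop.1 (hlim.eventually (mem_interior_iff_mem_nhds.1 hβ))
    refine measurable_of_tendsto_metrizable (f := fun n : ℕ => Υ.indicator fun x =>
      ((n + N : ℕ) : ℝ) • (f x (β₀ + ((n + N : ℕ) : ℝ)⁻¹ • v) - f x β₀)) (fun n => ?_) ?_
    · have h := ((hH2.2 _ (hN (n + N) (by omega))).sub (hH2.2 _ (interior_subset hβ))).const_smul
        ((n + N : ℕ) : ℝ)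
      exact h.measurable_indicator hΥ
    · refine tendsto_pi_nhds.2 fun x => ?_
      by_cases hx : x ∈ Υ
      · simp only [Set.indicator_of_mem hx]
        have h := (hH2.hasGradientAt hβ hx).hasFDerivAt.lim v (c := fun n : ℕ => (n : ℝ))
          (l := atTop) (by simpa using tendsto_natCast_atTop_atTop)
        have h2 := h.comp (tendsto_add_atTop_nat N)
        simpa [v, Function.comp_def, EuclideanSpace.inner_single_right] using h2
      · simp [Set.indicator_of_notMem hx]
  have h : Measurable fun x => WithLp.toLp 2 fun j => (Υ.indicator (fun x => gradBeta f x β₀) x) j :=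
    (WithLp.measurable_toLp 2 _).comp (measurable_pi_lambda _ hcoord)
  exact h

end Gradient

/-! ### Random vectors missing at random -/

namespace IsMARModel

variable {Ω : Type*} [MeasurableSpace Ω] {P : Measure Ω}
    {p d : ℕ} {Υ : Set (Euc p)} {Γ : Set (Euc d)} {f : Euc p → Euc d → ℝ} {β₀ : Euc d}
    {X : ℕ → Ω → Euc p} {ε Y δ : ℕ → Ω → ℝ} {sel : Euc p → ℝ}

lemma measurableSet_observed (hM : IsMARModel P Υ Γ f β₀ X ε Y δ sel) :
    MeasurableSet {ω | δ 0 ω = 1} :=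
  hM.measurable_δ 0 (measurableSet_singleton 1)

lemma integrable_sel (hM : IsMARModel P Υ Γ f β₀ X ε Y δ sel) :
    Integrable (fun ω => sel (X 0 ω)) P :=
  (integrable_congr (hM.selection 0)).1 integrable_condExp

lemma toNNReal_sel (hM : IsMARModel P Υ Γ f β₀ X ε Y δ sel) (ω : Ω) :
    ((sel (X 0 ω)).toNNReal : ℝ) = sel (X 0 ω) :=
  Real.coe_toNNReal _ (hM.selection_pos _ (hM.X_mem 0 ω)).le

lemma observed_mul_eq_indicator (hM : IsMARModel P Υ Γ f β₀ X ε Y δ sel) (h : Ω → ℝ) :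
    (fun ω => δ 0 ω * h ω) = {ω | δ 0 ω = 1}.indicator h := by
  funext ω
  rcases hM.δ_mem 0 ω with h0 | h1
  · rw [Set.indicator_of_notMem (by simp [h0]), h0, zero_mul]
  · rw [Set.indicator_of_mem (by exact h1), h1, one_mul]

/-- The law of `(ε, X)` is absolutely continuous, so it does not charge the hyperplane `ε = 0`. -/
lemma error_ne_zero (hM : IsMARModel P Υ Γ f β₀ X ε Y δ sel) : ∀ᵐ ω ∂P, ε 0 ω ≠ 0 := by
  have hV := (hM.measurable_ε 0).prodMk (hM.measurable_X 0)
  have h0 : (volume : Measure (ℝ × Euc p)) {z | z.1 = 0} = 0 := by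
    have : {z : ℝ × Euc p | z.1 = 0} = {0} ×ˢ Set.univ := by ext z; simp
    rw [this, Measure.volume_eq_prod, Measure.prod_prod]
    simp
  have h1 := hM.continuous_law h0
  rw [Measure.map_apply hV (measurableSet_eq_fun measurable_fst measurable_const)] at h1
  exact measure_eq_zero_iff_ae_notMem.1 h1

variable [IsProbabilityMeasure P]

/-- Since `ε` is a function of `(X, Y)`, the selection probability is also the conditional
probability of observation given `(ε, X)`: the observed law of `(ε, X)` has density `sel`. -/
lemma map_restrict_observed (hM : IsMARModel P Υ Γ f β₀ X ε Y δ sel)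
    (hf : ContinuousOn (fun x => f x β₀) Υ) :
    (P.restrict {ω | δ 0 ω = 1}).map (fun ω => (ε 0 ω, X 0 ω)) =
      (P.withDensity fun ω => ((sel (X 0 ω)).toNNReal : ENNReal)).map
        fun ω => (ε 0 ω, X 0 ω) := by
  have hF : Measurable (Υ.indicator fun x => f x β₀) :=
    hf.measurable_indicator hM.isCompact_covariates.measurableSet
  have hY : ∀ ω, Y 0 ω = Υ.indicator (fun x => f x β₀) (X 0 ω) + ε 0 ω := fun ω => by
    rw [Set.indicator_of_mem (hM.X_mem 0 ω), hM.regression]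
  have hX := hM.measurable_X 0
  have hε := hM.measurable_ε 0
  have hYm : Measurable (Y 0) := by
    rw [funext hY]
    exact (hF.comp hX).add hε
  have hV : Measurable fun ω => (ε 0 ω, X 0 ω) := hε.prodMk hX
  have hm : sigmaOf (fun ω => (X 0 ω, Y 0 ω)) ≤ ‹MeasurableSpace Ω› :=
    (hX.prodMk hYm).comap_le
  ext A hA
  have hS : MeasurableSet[sigmaOf fun ω => (X 0 ω, Y 0 ω)] ((fun ω => (ε 0 ω, X 0 ω)) ⁻¹' A) := by
    refine ⟨(fun z : Euc p × ℝ => (z.2 - Υ.indicator (fun x => f x β₀) z.1, z.1)) ⁻¹' A,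
      ((measurable_snd.sub (hF.comp measurable_fst)).prodMk measurable_fst) hA, ?_⟩
    ext ω
    simp [hY]
  have hSm := hV hA
  have hδ := hM.measurableSet_observed
  have h1 := setIntegral_condExp hm
    ((integrable_const (1 : ℝ)).indicator hδ (μ := P)) hS
  rw [setIntegral_congr_ae (g := fun ω => sel (X 0 ω)) hSm
    (((hM.missing_at_random 0).trans (hM.selection 0)).mono fun ω h _ => h),
    setIntegral_indicator hδ] at h1
  rw [Measure.map_apply hV hA, Measure.map_apply hV hA, Measure.restrict_apply hSm,
    withDensity_apply _ hSm]
  change _ = ∫⁻ ω in _, ENNReal.ofReal (sel (X 0 ω)) ∂P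
  rw [← ofReal_integral_eq_lintegral_ofReal hM.integrable_sel.restrict
    (ae_of_all _ fun ω => (hM.selection_pos _ (hM.X_mem 0 ω)).le), h1]
  simp

/-- Integrability transfers in both directions, as the two laws of `(ε, X)` agree as measures. -/
lemma integrable_observed_mul_iff (hM : IsMARModel P Υ Γ f β₀ X ε Y δ sel)
    (hf : ContinuousOn (fun x => f x β₀) Υ) {h : ℝ × Euc p → ℝ} (hh : Measurable h) :
    Integrable (fun ω => δ 0 ω * h (ε 0 ω, X 0 ω)) P ↔
      Integrable (fun ω => sel (X 0 ω) * h (ε 0 ω, X 0 ω)) P := by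
  have hV := (hM.measurable_ε 0).prodMk (hM.measurable_X 0)
  have hs : Measurable fun ω => (sel (X 0 ω)).toNNReal :=
    (hM.measurable_sel.comp (hM.measurable_X 0)).real_toNNReal
  have e : (fun ω => sel (X 0 ω) * h (ε 0 ω, X 0 ω)) =
      fun ω => (sel (X 0 ω)).toNNReal • h (ε 0 ω, X 0 ω) := by
    funext ω
    rw [NNReal.smul_def, hM.toNNReal_sel, smul_eq_mul]
  rw [hM.observed_mul_eq_indicator, integrable_indicator_iff hM.measurableSet_observed, e,
    ← integrable_withDensity_iff_integrable_smul hs]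
  exact (integrable_map_measure hh.aestronglyMeasurable hV.aemeasurable).symm.trans
    (by rw [hM.map_restrict_observed hf]
        exact integrable_map_measure hh.aestronglyMeasurable hV.aemeasurable)

lemma integral_observed_mul (hM : IsMARModel P Υ Γ f β₀ X ε Y δ sel)
    (hf : ContinuousOn (fun x => f x β₀) Υ) {h : ℝ × Euc p → ℝ} (hh : Measurable h) :
    ∫ ω, δ 0 ω * h (ε 0 ω, X 0 ω) ∂P = ∫ ω, sel (X 0 ω) * h (ε 0 ω, X 0 ω) ∂P := by
  have hV := (hM.measurable_ε 0).prodMk (hM.measurable_X 0)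
  have hs : Measurable fun ω => (sel (X 0 ω)).toNNReal :=
    (hM.measurable_sel.comp (hM.measurable_X 0)).real_toNNReal
  have e : (fun ω => sel (X 0 ω) * h (ε 0 ω, X 0 ω)) =
      fun ω => (sel (X 0 ω)).toNNReal • h (ε 0 ω, X 0 ω) := by
    funext ω
    rw [NNReal.smul_def, hM.toNNReal_sel, smul_eq_mul]
  rw [hM.observed_mul_eq_indicator, integral_indicator hM.measurableSet_observed, e,
    ← integral_withDensity_eq_integral_smul hs,
    ← integral_map (f := h) hV.aemeasurable hh.aestronglyMeasurable,
    ← integral_map (f := h) hV.aemeasurable hh.aestronglyMeasurable, hM.map_restrict_observed hf]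

end IsMARModel

/-! ### Complete-case scores -/

lemma sum_mul_integral_eq_integral_inner_sq {Ω : Type*} [MeasurableSpace Ω] {P : Measure Ω} {d : ℕ}
    {w : Ω → ℝ} {G : Ω → Euc d} (hi : ∀ j k, Integrable (fun ω => w ω * G ω j * G ω k) P)
    (x : Euc d) :
    Integrable (fun ω => w ω * inner ℝ (G ω) x ^ 2) P ∧
      star x.ofLp ⬝ᵥ (Matrix.of fun j k => ∫ ω, w ω * G ω j * G ω k ∂P).mulVec x.ofLp =
        ∫ ω, w ω * inner ℝ (G ω) x ^ 2 ∂P := by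
  have e : (fun ω => w ω * inner ℝ (G ω) x ^ 2) =
      fun ω => ∑ j, ∑ k, x j * x k * (w ω * G ω j * G ω k) := by
    funext ω
    simp only [inner_sq_eq_sum, Finset.mul_sum]
    exact Finset.sum_congr rfl fun j _ => Finset.sum_congr rfl fun k _ => by ring
  have hi' : ∀ j k, Integrable (fun ω => x j * x k * (w ω * G ω j * G ω k)) P := fun j k =>
    (hi j k).const_mul _
  rw [e]
  refine ⟨integrable_finsetSum _ fun j _ => integrable_finsetSum _ fun k _ => hi' j k, ?_⟩
  rw [integral_finsetSum _ fun j _ => integrable_finsetSum _ fun k _ => hi' j k]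
  simp only [dotProduct, Matrix.mulVec, Finset.mul_sum]
  refine Finset.sum_congr rfl fun j _ => ?_
  rw [integral_finsetSum _ fun k _ => hi' j k]
  refine Finset.sum_congr rfl fun k _ => ?_
  rw [integral_const_mul, Matrix.of_apply]
  simp
  ring

/-- If a weighted second moment matrix is positive definite then so is the one for any almost surely
positive weight: a direction `x` degenerate for `w` has `⟪G, x⟫ = 0` almost surely. -/
lemma posDef_integral_of_posDef {Ω : Type*} [MeasurableSpace Ω] {P : Measure Ω} {d : ℕ}
    {v w : Ω → ℝ} {G : Ω → Euc d} (hv : ∀ j k, Integrable (fun ω => v ω * G ω j * G ω k) P)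
    (hw : ∀ j k, Integrable (fun ω => w ω * G ω j * G ω k) P) (hw0 : ∀ᵐ ω ∂P, 0 < w ω)
    (hPD : (Matrix.of fun j k => ∫ ω, v ω * G ω j * G ω k ∂P).PosDef) :
    (Matrix.of fun j k => ∫ ω, w ω * G ω j * G ω k ∂P).PosDef := by
  refine Matrix.PosDef.of_dotProduct_mulVec_pos ?_ fun x hx => ?_
  · ext j k
    simp only [Matrix.conjTranspose_apply, Matrix.of_apply, star_trivial]
    exact integral_congr_ae (ae_of_all _ fun ω => by ring)
  obtain ⟨hiw, hew⟩ := sum_mul_integral_eq_integral_inner_sq hw (WithLp.toLp 2 x)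
  obtain ⟨-, hev⟩ := sum_mul_integral_eq_integral_inner_sq hv (WithLp.toLp 2 x)
  have hpos := hPD.dotProduct_mulVec_pos hx
  simp only at hew hev
  rw [hev] at hpos
  rw [hew]
  have hnn : 0 ≤ᵐ[P] fun ω => w ω * inner ℝ (G ω) (WithLp.toLp 2 x) ^ 2 := by
    filter_upwards [hw0] with ω h
    exact mul_nonneg h.le (sq_nonneg _)
  refine lt_of_le_of_ne (integral_nonneg_of_ae hnn) fun h0 => hpos.ne' ?_
  have h1 := (integral_eq_zero_iff_of_nonneg_ae hnn hiw).1 h0.symm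
  refine integral_eq_zero_of_ae ?_
  filter_upwards [h1, hw0] with ω h2 h3
  have h4 := (mul_eq_zero.1 h2).resolve_left h3.ne'
  simp only [h4, mul_zero, Pi.zero_apply]

namespace IsMARModel

variable {Ω : Type*} [MeasurableSpace Ω] {P : Measure Ω}
    {p d : ℕ} {Υ : Set (Euc p)} {Γ : Set (Euc d)} {f : Euc p → Euc d → ℝ} {β₀ : Euc d}
    {X : ℕ → Ω → Euc p} {ε Y δ : ℕ → Ω → ℝ} {sel : Euc p → ℝ}

lemma norm_gradBeta_apply_le (hM : IsMARModel P Υ Γ f β₀ X ε Y δ sel) {C : ℝ}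
    (hC : ∀ᶠ b in 𝓝 β₀, ∀ x ∈ Υ, ‖gradBeta f x b‖ ≤ C ∧ ‖hessBeta f x b‖ ≤ C) (ω : Ω) (j : Fin d) :
    ‖gradBeta f (X 0 ω) β₀ j‖ ≤ C :=
  (PiLp.norm_apply_le _ j).trans (hC.self_of_nhds _ (hM.X_mem 0 ω)).1

lemma measurable_gradBeta (hM : IsMARModel P Υ Γ f β₀ X ε Y δ sel) (hH2 : AssumptionH2 Υ Γ f) :
    Measurable fun ω => gradBeta f (X 0 ω) β₀ := by
  have h := (hH2.measurable_indicator_gradBeta hM.true_mem_interior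
    hM.isCompact_covariates.measurableSet).comp (hM.measurable_X 0)
  convert! h using 1
  funext ω
  exact (Set.indicator_of_mem (hM.X_mem 0 ω) (fun x => gradBeta f x β₀)).symm

lemma integrable_sel_mul_gradBeta (hM : IsMARModel P Υ Γ f β₀ X ε Y δ sel)
    (hH2 : AssumptionH2 Υ Γ f) (hH4 : AssumptionH4 Υ f β₀) (j k : Fin d) :
    Integrable (fun ω => sel (X 0 ω) * gradBeta f (X 0 ω) β₀ j * gradBeta f (X 0 ω) β₀ k) P := by
  obtain ⟨C, hC⟩ := hH4
  have hm := hM.measurable_gradBeta hH2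
  have hmj : ∀ j, Measurable fun ω => gradBeta f (X 0 ω) β₀ j := fun j => by fun_prop
  exact (hM.integrable_sel.mul_bdd (hmj j).aestronglyMeasurable
      (ae_of_all _ fun ω => hM.norm_gradBeta_apply_le hC ω j)).mul_bdd (hmj k).aestronglyMeasurable
      (ae_of_all _ fun ω => hM.norm_gradBeta_apply_le hC ω k)

variable [IsProbabilityMeasure P]

/-- Both estimating functions have the form `δ s(ε) ∂f(X,β⁰)/∂β`, with `s` the identity for least
squares and `s = sign` for least absolute deviations. -/
theorem tendstoInDistribution_elLogRatio_score (hM : IsMARModel P Υ Γ f β₀ X ε Y δ sel)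
    (hH2 : AssumptionH2 Υ Γ f) (hH4 : AssumptionH4 Υ f β₀)
    (hHA : (matA P f β₀ (X 0) sel).PosDef) {s : ℝ → ℝ} (hs : Measurable s)
    (hs0 : ∀ᵐ ω ∂P, s (ε 0 ω) ≠ 0) (hsi : Integrable (fun ω => s (ε 0 ω)) P)
    (hsm : P[fun ω => s (ε 0 ω) | sigmaOf (X 0)] =ᵐ[P] 0)
    (hint : ∀ j k, Integrable (fun ω => s (ε 0 ω) ^ 2 * sel (X 0 ω) *
      gradBeta f (X 0 ω) β₀ j * gradBeta f (X 0 ω) β₀ k) P) :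
    TendstoInDistribution (fun n ω => elLogRatio fun i : Fin n =>
      (δ i ω * s (ε i ω)) • gradBeta f (X i ω) β₀) atTop
      (fun t : ℝ => (t : EReal)) (fun _ => P) (chiSquared d) := by
  have hf : ContinuousOn (fun x => f x β₀) Υ := hH2.2 _ (interior_subset hM.true_mem_interior)
  set G : Euc p → Euc d := Υ.indicator fun x => gradBeta f x β₀ with hGdef
  have hGm : Measurable G := hH2.measurable_indicator_gradBeta hM.true_mem_interior
    hM.isCompact_covariates.measurableSet
  have hG : ∀ i ω, gradBeta f (X i ω) β₀ = G (X i ω) := fun i ω =>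
    (Set.indicator_of_mem (hM.X_mem i ω) (fun x => gradBeta f x β₀)).symm
  have hGj : ∀ j, Measurable fun x => G x j := fun j => by fun_prop
  have hX := hM.measurable_X 0
  have hε := hM.measurable_ε 0
  have hAint := hM.integrable_sel_mul_gradBeta hH2 hH4
  simp only [hG] at hint hAint ⊢
  unfold matA at hHA
  simp only [hG] at hHA
  have hψ : Measurable fun q : ℝ × Euc p × ℝ => (q.2.2 * s q.1) • G q.2.1 := by fun_prop
  have hδ2 : ∀ ω, δ 0 ω * δ 0 ω = δ 0 ω := fun ω => by
    rcases hM.δ_mem 0 ω with h | h <;> simp [h]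
  have hprod : ∀ j k ω, ((δ 0 ω * s (ε 0 ω)) • G (X 0 ω)) j * ((δ 0 ω * s (ε 0 ω)) • G (X 0 ω)) k =
      δ 0 ω * (fun q : ℝ × Euc p => s q.1 ^ 2 * G q.2 j * G q.2 k) (ε 0 ω, X 0 ω) := by
    intro j k ω
    simp only [PiLp.smul_apply, smul_eq_mul]
    linear_combination (s (ε 0 ω) ^ 2 * G (X 0 ω) j * G (X 0 ω) k) * hδ2 ω
  have hh : ∀ j k, Measurable fun q : ℝ × Euc p => s q.1 ^ 2 * G q.2 j * G q.2 k := fun j k => by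
    fun_prop
  have hcov : ∀ j k, ∫ ω, ((δ 0 ω * s (ε 0 ω)) • G (X 0 ω)) j *
      ((δ 0 ω * s (ε 0 ω)) • G (X 0 ω)) k ∂P =
      ∫ ω, s (ε 0 ω) ^ 2 * sel (X 0 ω) * G (X 0 ω) j * G (X 0 ω) k ∂P := by
    intro j k
    simp only [hprod]
    rw [hM.integral_observed_mul hf (hh j k)]
    exact integral_congr_ae (ae_of_all _ fun ω => by ring)
  have hL2 : ∀ j, MemLp (fun ω => ((δ 0 ω * s (ε 0 ω)) • G (X 0 ω)) j) 2 P := by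
    intro j
    have hmeas : Measurable fun ω => ((δ 0 ω * s (ε 0 ω)) • G (X 0 ω)) j := by
      have := hM.measurable_δ 0
      fun_prop
    rw [memLp_two_iff_integrable_sq hmeas.aestronglyMeasurable]
    refine (integrable_congr (ae_of_all _ fun ω => (sq _).trans (hprod j j ω))).2
      ((hM.integrable_observed_mul_iff hf (hh j j)).2 ?_)
    exact (hint j j).congr (ae_of_all _ fun ω => by ring)
  have hmean : ∀ j, ∫ ω, ((δ 0 ω * s (ε 0 ω)) • G (X 0 ω)) j ∂P = 0 := by
    intro j
    have hj : Measurable fun q : ℝ × Euc p => s q.1 * G q.2 j := by fun_prop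
    have e : ∀ ω, ((δ 0 ω * s (ε 0 ω)) • G (X 0 ω)) j =
        δ 0 ω * (fun q : ℝ × Euc p => s q.1 * G q.2 j) (ε 0 ω, X 0 ω) := fun ω => by
      simp only [PiLp.smul_apply, smul_eq_mul]
      ring
    have hi := (hL2 j).integrable one_le_two
    simp only [e] at hi ⊢
    rw [hM.integrable_observed_mul_iff hf hj] at hi
    rw [hM.integral_observed_mul hf hj]
    have hsG : StronglyMeasurable[sigmaOf (X 0)] fun ω => sel (X 0 ω) * G (X 0 ω) j := by
      have h1 : Measurable fun x => sel x * G x j := hM.measurable_sel.mul (hGj j)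
      exact (h1.comp (comap_measurable (X 0))).stronglyMeasurable
    have e2 : (fun ω => sel (X 0 ω) * (s (ε 0 ω) * G (X 0 ω) j)) =
        (fun ω => sel (X 0 ω) * G (X 0 ω) j) * fun ω => s (ε 0 ω) := by
      funext ω
      simp only [Pi.mul_apply]
      ring
    simp only at hi ⊢
    rw [e2] at hi ⊢
    rw [← integral_condExp hX.comap_le, integral_congr_ae
      (condExp_mul_of_stronglyMeasurable_left hsG hi hsi)]
    refine integral_eq_zero_of_ae ?_
    filter_upwards [hsm] with ω hω
    simp [hω]
  refine tendstoInDistribution_elLogRatio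
    (g := fun i ω => (δ i ω * s (ε i ω)) • G (X i ω))
    (fun i => hψ.comp ((hM.measurable_ε i).prodMk ((hM.measurable_X i).prodMk (hM.measurable_δ i))))
    (hM.indep.comp (fun _ => _) fun _ => hψ) (fun i => (hM.identDistrib i).comp hψ) hL2 hmean ?_
  simp only [hcov]
  refine posDef_integral_of_posDef hAint hint ?_ hHA
  filter_upwards [hs0] with ω hω
  have := hM.selection_pos _ (hM.X_mem 0 ω)
  positivity

end IsMARModel

theorem theorem1 {Ω : Type*} [MeasurableSpace Ω] (P : Measure Ω) [IsProbabilityMeasure P]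
    {p d : ℕ} (Υ : Set (Euc p)) (Γ : Set (Euc d)) (f : Euc p → Euc d → ℝ) (β₀ : Euc d)
    (X : ℕ → Ω → Euc p) (ε Y δ : ℕ → Ω → ℝ) (sel : Euc p → ℝ)
    (hModel : IsMARModel P Υ Γ f β₀ X ε Y δ sel)
    (hH2 : AssumptionH2 Υ Γ f) (hH4 : AssumptionH4 Υ f β₀)
    (hHA : (matA P f β₀ (X 0) sel).PosDef) :
    (AssumptionH1 P f β₀ X ε sel →
      TendstoInDistribution (fun n => lLS f X Y δ n β₀) atTop
        (fun t : ℝ => (t : EReal)) (fun _ => P) (chiSquared d)) ∧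
    (AssumptionH1bis P X ε →
      TendstoInDistribution (fun n => lLAD f X Y δ n β₀) atTop
        (fun t : ℝ => (t : EReal)) (fun _ => P) (chiSquared d)) := by
  have hres : ∀ i ω, Y i ω - f (X i ω) β₀ = ε i ω := fun i ω => by
    rw [hModel.regression]
    ring
  constructor
  · intro h1
    have h := hModel.tendstoInDistribution_elLogRatio_score hH2 hH4 hHA (s := fun t => t)
      measurable_id hModel.error_ne_zero (h1.integrable 0) (h1.condMean 0) h1.finite_B
    refine h.congr (fun n => ae_of_all _ fun ω => ?_) (ae_of_all _ fun _ => rfl)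
    simp only [lLS, scoreLS, hres]
  · intro h1
    have hsb : ∀ t : ℝ, ‖Real.sign t‖ ≤ 1 := fun t => by
      rcases Real.sign_apply_eq t with h | h | h <;> simp [h]
    have hsign : Measurable fun ω => Real.sign (ε 0 ω) :=
      Real.measurable_sign.comp (hModel.measurable_ε 0)
    have h := hModel.tendstoInDistribution_elLogRatio_score hH2 hH4 hHA (s := Real.sign)
      Real.measurable_sign
      (hModel.error_ne_zero.mono fun ω hω => mt Real.sign_eq_zero_iff.1 hω)
      (Integrable.of_bound hsign.aestronglyMeasurable 1 (ae_of_all _ fun ω => hsb _))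
      (h1.condSign 0) fun j k => by
        refine ((hModel.integrable_sel_mul_gradBeta hH2 hH4 j k).bdd_mul (c := 1)
          (hsign.pow_const 2).aestronglyMeasurable (ae_of_all _ fun ω => ?_)).congr
          (ae_of_all _ fun ω => by ring)
        rw [norm_pow]
        exact pow_le_one₀ (norm_nonneg _) (hsb _)
    refine h.congr (fun n => ae_of_all _ fun ω => ?_) (ae_of_all _ fun _ => rfl)
    simp only [lLAD, scoreLAD, hres]
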